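/- **Notation.** Let $0<r<n$ be integers, $r'=n \bmod r$, $f=\lfloor n/r\rfloor$, $c=\lceil n/r\rceil$. $N_r\in\mathfrak{gl}_n(\mathbb C)$ is the matrix with ones on the $r$-th subdiagonal and zeros elsewhere. A partition $\lambda$ of $n$ is a multiset of positive integers with sum $n$; $m_\lambda(x)$ is the multiplicity of $x$ in $\lambda$ and $|\lambda|$ the number of parts. $\lambda$ dominates $\mu$ if $|\lambda|\le|\mu|$ and, for every $1\le j\le|\lambda|$, the sum of the $j$ largest parts of $\lambda$ is at least that of the $j$ largest parts of $\mu$. A matrix is nilpotent of type $\lambda$ if it is nilpotent and the multiset of its Jordan block sizes is $\lambda$. **Graphs.** A graph is a set of arrows on the vertices $1,\dots,n$ together with an embedding $v\mapsto(x(v),y(v))$ of the vertices into $\mathbb Z_{>0}\times\mathbb Z_{>0}$. Its matrix has $(v,u)$ entry $1$ if $u\mapsto v$ is an arrow and $0$ otherwise. Column $i$ is the set of vertices with $x(v)=i$; its height $h(i)$ is the maximal $y(v)$ in it, and $h(i)=0$ if column $i$ is empty. A vertex $w$ is below $v$ (and $v$ is above $w$) if $x(w)=x(v)$ and $y(w)=y(v)-1$.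 The graph is *properly downward* if $y(v)>y(w)$ for every arrow $v\mapsto w$; every $v$ with $y(v)>1$ has an arrow to a vertex below it; and $x(v)\le x(w)$ for every arrow $v\mapsto w$ with $y(v)=y(w)+1$. Column $i$ is a *downward path* if every vertex $v$ in it has an arrow exactly to the vertex below it, and from the vertex above it, whenever these exist, and to or from no other vertex. *Grafting $m$ vertices from column $t$ to column $s$* is defined if the graph is properly downward, column $t$ is a downward path, $0<s<t$ and $0<m\le h(t)$. It adds an arrow from the vertex at $(t,h(t)-m+1)$ to the vertex at $(s,h(s))$ (no arrow if column $s$ is empty) and moves the vertex at $(t,h(t)-m+i)$ to $(s,h(s)+i)$ for $1\le i\le m$. **Algorithm.** The input is $r<n$ and a partition $\lambda$ of $n$. The state consists of a graph, two column pointers $s,t$ and two multisets $L,S$. Initially the graph is that of $N_r$ with vertex $v$ at position $r-((n-v)\bmod r)$ and level $\lfloor (n-v)/r\rfloor+1$; $L$ consists of the parts of $\lambda$ greater than $c$ and, if $r'\ne0$ and $m_\lambda(c)>r'$, also $m_\lambda(c)-r'$ copies of $c$; $S$ consists of the parts of $\lambda$ less than $f$ and, if $m_\lambda(f)>r-r'$,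 also $m_\lambda(f)-(r-r')$ copies of $f$; $s=\min\{m_\lambda(f),r-r'\}+1$ and $t=s+1$. Below, $M=\max L$ and $m=\max S$; to delete $M$ or $m$ is to remove one copy of it from $L$ or $S$. *Loop 1.* While $S\neq\emptyset$, carry out the first of the following cases that applies. - (1a) $M-h(s)=h(t)-m+1$ and $h(t)<h(t+1)$: graft $h(t+1)-m$ vertices from $t+1$ to $s$; delete $m$ and $M$; set $(s,t)\gets(t,t+2)$. - (1b) $M-h(s)>h(t)-m$: graft $h(t)-m$ vertices from $t$ to $s$; delete $m$; set $t\gets t+1$. - (1c) $M-h(s)=h(t)-m$: graft $h(t)-m$ vertices from $t$ to $s$; delete $m$ and $M$; set $(s,t)\gets(t+1,t+2)$. - (1d) $M-h(s)<h(t)-m$: graft $M-h(s)$ vertices from $t$ to $s$; delete $M$; set $(s,t)\gets(t,t+1)$. *Loop 2.* While $L\neq\emptyset$: first, while $M-h(s)>c$, graft $h(t)$ vertices from $t$ to $s$ and set $t\gets t+1$. Then carry out the applicable one of the following cases, and delete $M$. - (2a) $M-h(s)>h(t)$ and $h(t+1)=c$: graft $h(t+1)$ vertices from $t+1$ to $s$;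 set $(s,t)\gets(t,t+2)$. - (2b) $M-h(s)>h(t)$ and $h(t+1)=f\neq c$: graft $h(t)$ vertices from $t$ to $s$, then one vertex from $t+1$ to $s$; set $(s,t)\gets(t+1,t+2)$. - (2c) $M-h(s)=h(t)$: graft $h(t)$ vertices from $t$ to $s$; set $(s,t)\gets(t+1,t+2)$. - (2d) $M-h(s)<h(t)$: graft $M-h(s)$ vertices from $t$ to $s$; set $(s,t)\gets(t,t+1)$. An iteration is well defined if every graft in it is defined, every maximum evaluated is that of a nonempty multiset, every column $t$ or $t+1$ whose height is evaluated is nonempty (the second condition of (1a), (2a), (2b) is evaluated only if the first one holds), and one of the cases applies. **Theorem.** Let $0<r<n$ and let $\lambda$ be a partition of $n$. 1. If $\lambda$ has at most $r$ parts, then every step of the algorithm is well defined and the algorithm terminates, in a unique final state. The matrix of the final graph is $N_r+X_\lambda$, where $X_\lambda$ is binary (all entries are $0$ or $1$) and strictly upper triangular, and $N_r+X_\lambda$ is nilpotent of type $\lambda$. 2. Consequently the algorithm solves the Upper Nilpotent Completion Problem for $A=N_r$: if $\mu$ is the partition of $n$ such that $N_r$ is nilpotent of type $\mu$, and $\lambda$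 dominates $\mu$, then the algorithm terminates on input $r,\lambda$, all its steps being well defined, and its output $X_\lambda$ is a binary strictly upper triangular matrix such that $N_r+X_\lambda$ is nilpotent of type $\lambda$. -/

import Mathlib

namespace NilpotentCompletion

/-! ### Matrices, Jordan type and dominance order -/

/-- The `n × n` complex matrix `N_r`: ones on the `r`-th subdiagonal and zeros elsewhere. -/
def subdiagonalMatrix (n r : ℕ) : Matrix (Fin n) (Fin n) ℂ :=
  Matrix.of fun i j => if (i : ℕ) = (j : ℕ) + r then 1 else 0

/-- All entries on and below the diagonal vanish. -/
def IsStrictlyUpper {n : ℕ} (X : Matrix (Fin n) (Fin n) ℂ) : Prop :=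
  ∀ i j, j ≤ i → X i j = 0

/-- Every entry is zero or one. -/
def IsBinary {n : ℕ} (X : Matrix (Fin n) (Fin n) ℂ) : Prop :=
  ∀ i j, X i j = 0 ∨ X i j = 1

/-- The nilpotent Jordan matrix with blocks of sizes `sizes 0, …, sizes (k - 1)`. -/
def jordanMatrix {k : ℕ} (sizes : Fin k → ℕ) :
    Matrix (Σ i, Fin (sizes i)) (Σ i, Fin (sizes i)) ℂ :=
  Matrix.blockDiagonal' fun _ => Matrix.of fun a b => if (a : ℕ) + 1 = (b : ℕ) then 1 else 0

/-- `A` is nilpotent of type `lam`: it is nilpotent and is conjugate under `GL_n(ℂ)` to a nilpotent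
Jordan matrix whose multiset of block sizes is `lam`. -/
def IsNilpotentOfType {n : ℕ} (A : Matrix (Fin n) (Fin n) ℂ) (lam : n.Partition) : Prop :=
  IsNilpotent A ∧
    ∃ (k : ℕ) (sizes : Fin k → ℕ) (e : (Σ i, Fin (sizes i)) ≃ Fin n)
      (P : Matrix.GeneralLinearGroup (Fin n) ℂ),
      Finset.univ.val.map sizes = lam.parts ∧
      A = (P : Matrix (Fin n) (Fin n) ℂ) * Matrix.reindex e e (jordanMatrix sizes) *
        ((P⁻¹ : Matrix.GeneralLinearGroup (Fin n) ℂ) : Matrix (Fin n) (Fin n) ℂ)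

/-- The dominance order: `lam` dominates `mu`. -/
def Dominates {n : ℕ} (lam mu : n.Partition) : Prop :=
  lam.parts.card ≤ mu.parts.card ∧
    ∀ j, 1 ≤ j → j ≤ lam.parts.card →
      ((mu.parts.sort (· ≥ ·)).take j).sum ≤ ((lam.parts.sort (· ≥ ·)).take j).sum

/-! ### Graphs

The vertices are the elements of `Fin n`; the ordinal of the vertex `v` is `v + 1`.  Every arrow has
weight one. -/

/-- A graph on `n` vertices: a set of arrows (the pair `(u, v)` is the arrow `u ↦ v`), together
with the coordinates (position, level) of each vertex. -/
structure Graph (n : ℕ) where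
  arrows : Finset (Fin n × Fin n)
  coord : Fin n → ℕ × ℕ

namespace Graph

variable {n : ℕ}

/-- The binary matrix whose `(v, u)` entry is one if and only if `u ↦ v` is an arrow. -/
def toMatrix (G : Graph n) : Matrix (Fin n) (Fin n) ℂ :=
  Matrix.of fun v u => if (u, v) ∈ G.arrows then 1 else 0

/-- The position of a vertex. -/
def x (G : Graph n) (v : Fin n) : ℕ := (G.coord v).1

/-- The level of a vertex. -/
def y (G : Graph n) (v : Fin n) : ℕ := (G.coord v).2

/-- The coordinates embed the vertex set into pairs of positive integers. -/
def IsEmbedded (G : Graph n) : Prop :=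
  (∀ u v, G.coord u = G.coord v → u = v) ∧ ∀ v, 0 < G.x v ∧ 0 < G.y v

/-- The vertex `v` is (directly) above the vertex `w`, i.e. `w` is (directly) below `v`. -/
def Above (G : Graph n) (v w : Fin n) : Prop := G.x v = G.x w ∧ G.y v = G.y w + 1

/-- Properly downward graphs. -/
def IsProperlyDownward (G : Graph n) : Prop :=
  (∀ v w, (v, w) ∈ G.arrows → G.y w < G.y v) ∧
  (∀ v, 1 < G.y v → ∃ w, G.Above v w ∧ (v, w) ∈ G.arrows) ∧
  (∀ v w, (v, w) ∈ G.arrows → G.y v = G.y w + 1 → G.x v ≤ G.x w)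

/-- Column `i`: the set of vertices at position `i`. -/
def column (G : Graph n) (i : ℕ) : Finset (Fin n) := Finset.univ.filter fun v => G.x v = i

/-- The height of column `i`; an empty column has height zero. -/
def height (G : Graph n) (i : ℕ) : ℕ := (G.column i).sup G.y

/-- The height of column `i`, undefined (`none`) if column `i` is empty. -/
def height? (G : Graph n) (i : ℕ) : Option ℕ :=
  if (G.column i).Nonempty then some (G.height i) else none

/-- Column `i` is a downward path. -/
def IsDownwardPath (G : Graph n) (i : ℕ) : Prop :=
  ∀ v, G.x v = i → ∀ w, ((v, w) ∈ G.arrows ↔ G.Above v w) ∧ ((w, v) ∈ G.arrows ↔ G.Above w v)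

/-- The conditions under which `m` vertices of `G` may be grafted from column `stock` to column
`scion`.  (Column `stock` is nonempty because of `0 < m ≤ height`; column `scion` may be empty.) -/
def CanGraft (G : Graph n) (m stock scion : ℕ) : Prop :=
  G.IsEmbedded ∧ G.IsProperlyDownward ∧ G.IsDownwardPath stock ∧
    0 < scion ∧ scion < stock ∧ 0 < m ∧ m ≤ G.height stock

instance (G : Graph n) : Decidable G.IsEmbedded := by
  unfold IsEmbedded; infer_instance

instance (G : Graph n) (v w : Fin n) : Decidable (G.Above v w) := by
  unfold Above; infer_instance

instance (G : Graph n) : Decidable G.IsProperlyDownward := by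
  unfold IsProperlyDownward; infer_instance

instance (G : Graph n) (i : ℕ) : Decidable (G.IsDownwardPath i) := by
  unfold IsDownwardPath; infer_instance

instance (G : Graph n) (m stock scion : ℕ) : Decidable (G.CanGraft m stock scion) := by
  unfold CanGraft; infer_instance

/-- Grafting `m` vertices from column `stock` to column `scion`: an arrow is added from the lowest
grafted vertex to the top vertex of column `scion` (no arrow if that column is empty, as no vertex
has level zero), and the top `m` vertices of column `stock` are translated to the top of column
`scion`.  Undefined (`none`) if the conditions for grafting are violated. -/
def graft (G : Graph n) (m stock scion : ℕ) : Option (Graph n) :=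
  if G.CanGraft m stock scion then
    some
      { arrows := G.arrows ∪ Finset.univ.filter fun a : Fin n × Fin n =>
          G.coord a.1 = (stock, G.height stock - m + 1) ∧ G.coord a.2 = (scion, G.height scion)
        coord := fun v =>
          if G.x v = stock ∧ G.height stock - m < G.y v then
            (scion, G.height scion + (G.y v - (G.height stock - m)))
          else G.coord v }
  else none

/-- The graph of `N_r`, embedded with its vertices ordered by type-writer traversal: column `i`
(`1 ≤ i ≤ r`) is a downward path, the bottom row consists of the last `r` vertices, and the
incomplete top row (if any) is aligned to the right. -/
def ofSubdiagonal (n r : ℕ) : Graph n where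
  arrows := Finset.univ.filter fun a : Fin n × Fin n => (a.2 : ℕ) = (a.1 : ℕ) + r
  coord := fun v => (r - (n - 1 - (v : ℕ)) % r, (n - 1 - (v : ℕ)) / r + 1)

end Graph

/-! ### The algorithm

Partial operations take values in `Option`; `none` means that an instruction or an expression is
not well defined.  Conditions that contain differences are evaluated in `ℤ`.  The number of vertices
to be grafted is a difference of natural numbers; if it is not positive, it is `0` in `ℕ` and the
graft is undefined. -/

/-- The maximum of a multiset, undefined for the empty multiset. -/
def max? (s : Multiset ℕ) : Option ℕ := if s = 0 then none else some s.sup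

/-- The state of the algorithm: the graph, the two column pointers (vertices are grafted from the
column `stock`, or from the one after it, to the column `scion`), and the two multisets of the parts
still to be made, those longer and those shorter than the available columns. -/
structure State (n : ℕ) where
  graph : Graph n
  scion : ℕ
  stock : ℕ
  long : Multiset ℕ
  short : Multiset ℕ

section Algorithm

variable {n : ℕ}

/-- The state after initialization. -/
def initialState (r : ℕ) (lam : n.Partition) : State n where
  graph := Graph.ofSubdiagonal n r
  scion := min (lam.parts.count (n / r)) (r - n % r) + 1
  stock := min (lam.parts.count (n / r)) (r - n % r) + 1 + 1
  long := lam.parts.filter (fun p => n ⌈/⌉ r < p) +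
    if n % r ≠ 0 ∧ n % r < lam.parts.count (n ⌈/⌉ r) then
      Multiset.replicate (lam.parts.count (n ⌈/⌉ r) - n % r) (n ⌈/⌉ r) else 0
  short := lam.parts.filter (fun p => p < n / r) +
    if r - n % r < lam.parts.count (n / r) then
      Multiset.replicate (lam.parts.count (n / r) - (r - n % r)) (n / r) else 0

/-- One iteration of Loop 1. -/
def loop1Body (S : State n) : Option (State n) := do
  let M ← max? S.long
  let m ← max? S.short
  let hs ← S.graph.height? S.stock
  let ht := S.graph.height S.scion
  -- the height of the column after `stock` is only evaluated if the first condition holds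
  let case1a ←
    if (M : ℤ) - ht = (hs : ℤ) - m + 1 then
      (S.graph.height? (S.stock + 1)).map fun hs' => decide (hs < hs')
    else some false
  if case1a then
    let G ← S.graph.graft (S.graph.height (S.stock + 1) - m) (S.stock + 1) S.scion
    some { graph := G, scion := S.stock, stock := S.stock + 2,
           long := S.long - {M}, short := S.short - {m} }
  else if (M : ℤ) - ht > (hs : ℤ) - m then
    let G ← S.graph.graft (hs - m) S.stock S.scion
    some { graph := G, scion := S.scion, stock := S.stock + 1,
           long := S.long, short := S.short - {m} }
  else if (M : ℤ) - ht = (hs : ℤ) - m then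
    let G ← S.graph.graft (hs - m) S.stock S.scion
    some { graph := G, scion := S.stock + 1, stock := S.stock + 2,
           long := S.long - {M}, short := S.short - {m} }
  else
    let G ← S.graph.graft (M - ht) S.stock S.scion
    some { graph := G, scion := S.stock, stock := S.stock + 1,
           long := S.long - {M}, short := S.short }

/-- The condition of the Little Loop. -/
def littleLoopCond (r : ℕ) (S : State n) : Option Bool := do
  let M ← max? S.long
  some (decide ((M : ℤ) - S.graph.height S.scion > (n ⌈/⌉ r : ℕ)))

/-- One iteration of the Little Loop. -/
def littleLoopBody (S : State n) : Option (State n) := do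
  let hs ← S.graph.height? S.stock
  let G ← S.graph.graft hs S.stock S.scion
  some { S with graph := G, stock := S.stock + 1 }

/-- The part of an iteration of Loop 2 that follows the Little Loop.  It is undefined if none of the
four cases applies. -/
def loop2Finish (r : ℕ) (S : State n) : Option (State n) := do
  let M ← max? S.long
  let hs ← S.graph.height? S.stock
  let ht := S.graph.height S.scion
  if (M : ℤ) - ht > hs then
    let hs' ← S.graph.height? (S.stock + 1)
    if hs' = n ⌈/⌉ r then
      let G ← S.graph.graft hs' (S.stock + 1) S.scion
      some { graph := G, scion := S.stock, stock := S.stock + 2,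
             long := S.long - {M}, short := S.short }
    else if hs' = n / r then
      let G ← S.graph.graft hs S.stock S.scion
      let G' ← G.graft 1 (S.stock + 1) S.scion
      some { graph := G', scion := S.stock + 1, stock := S.stock + 2,
             long := S.long - {M}, short := S.short }
    else none
  else if (M : ℤ) - ht = hs then
    let G ← S.graph.graft hs S.stock S.scion
    some { graph := G, scion := S.stock + 1, stock := S.stock + 2,
           long := S.long - {M}, short := S.short }
  else
    let G ← S.graph.graft (M - ht) S.stock S.scion
    some { graph := G, scion := S.stock, stock := S.stock + 1,
           long := S.long - {M}, short := S.short }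

/-- `WhileRun cond body s t`: the loop `while cond do body`, started in `s`, terminates in `t` after
finitely many iterations in each of which the condition and the body are well defined. -/
inductive WhileRun {σ : Type} (cond : σ → Option Bool) (body : σ → σ → Prop) : σ → σ → Prop
  | done {s : σ} : cond s = some false → WhileRun cond body s s
  | step {s t u : σ} : cond s = some true → body s t → WhileRun cond body t u →
      WhileRun cond body s u

/-- Loop 1: while `short` is nonempty. -/
def Loop1 : State n → State n → Prop :=
  WhileRun (fun S => some (decide (S.short ≠ 0))) fun S T => loop1Body S = some T

/-- The Little Loop. -/
def LittleLoop (r : ℕ) : State n → State n → Prop :=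
  WhileRun (littleLoopCond r) fun S T => littleLoopBody S = some T

/-- Loop 2: while `long` is nonempty. -/
def Loop2 (r : ℕ) : State n → State n → Prop :=
  WhileRun (fun S => some (decide (S.long ≠ 0)))
    fun S T => ∃ S', LittleLoop r S S' ∧ loop2Finish r S' = some T

/-- The algorithm, on input `r` and `lam`, is well defined at every step and terminates in the
state `T`. -/
def TerminatesIn (r : ℕ) (lam : n.Partition) (T : State n) : Prop :=
  ∃ S, Loop1 (initialState r lam) S ∧ Loop2 r S T

/-- The matrix `X` for which the matrix of the graph of the state `T` is `N_r + X`. -/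
def State.completion (T : State n) (r : ℕ) : Matrix (Fin n) (Fin n) ℂ :=
  T.graph.toMatrix - subdiagonalMatrix n r

end Algorithm

end NilpotentCompletion

namespace NilpotentCompletion

/-! ### The Jordan type of a properly downward graph -/

/-! Two facts carry the proof. First, the matrix of an embedded, properly downward graph is
nilpotent, and its Jordan blocks have the sizes of the nonempty columns
(`Graph.isNilpotentOfType_toMatrix`): the top vertex of a column generates a Jordan chain whose
members are the vertices of that column up to vertices which are lower, or equally high and further
right. Hence it is enough to reach a properly downward graph with column heights `lam`.

Second, one numerical condition makes a graft harmless (`Graph.IsGrafted.graft`): the lowest grafted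
vertex has level at most `max 1 l`, where `l` bounds from below both the height of the scion and the
original level of its top vertex. The graph then stays properly downward. The new arrow also gives
an entry above the diagonal: in the graph of `N_r` ordinals grow from left to right and shrink
upwards, so a top vertex that came from an earlier column and from at least the same level has the
smaller ordinal.

It remains to show that the algorithm grafts only under this condition and never lacks a column.
Columns that already are parts of size `f` or `c` are set aside at the left and right ends. The
columns in between have heights `f`, then `c ≤ f + 1`, and are consumed from left to right. The
invariant says that the remaining heights and the remaining parts have equal sums, that short parts
are less than `l` (so a column may be cut down to one), and that the next column may be cut so as to
complete the longest part (`Invariant.reach`). In Loop 1 the remaining parts are also no more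
numerous than the remaining columns, so a short part is always accompanied by a long one. The
dangerous configuration is a scion one vertex too short, made with a column of height `f` and facing
a column of height `c = f + 1`; cases (1a) and (2a) avoid it.

The second statement reduces to the first because `N_r` has at most `r` Jordan blocks
(`card_parts_le_of_isNilpotentOfType`). -/

/-- A square matrix which is unitriangular with respect to an injective key in a linear order is
invertible. -/
theorem det_ne_zero_of_unitriangular {ι α : Type*} [Fintype ι] [DecidableEq ι] [LinearOrder α]
    {P : Matrix ι ι ℂ} {key : ι → α} (h1 : ∀ v, P v v = 1)
    (h2 : ∀ u v, P u v ≠ 0 → u = v ∨ key u < key v) : P.det ≠ 0 := by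
  intro hdet
  obtain ⟨c, hc, hPc⟩ := Matrix.exists_mulVec_eq_zero_iff.2 hdet
  have hne : (Finset.univ.filter fun v => c v ≠ 0).Nonempty := by
    by_contra h
    rw [Finset.not_nonempty_iff_eq_empty, Finset.filter_eq_empty_iff] at h
    exact hc (funext fun v => not_not.1 (h (Finset.mem_univ v)))
  obtain ⟨v, hv, hmax⟩ := Finset.exists_max_image _ key hne
  simp only [Finset.mem_filter, Finset.mem_univ, true_and] at hv hmax
  have hs := congrFun hPc v
  rw [Matrix.mulVec, dotProduct, Finset.sum_eq_single v] at hs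
  · rw [h1, one_mul] at hs
    exact hv hs
  · intro u _ hu
    by_contra h
    have hk := hmax u (right_ne_zero_of_mul h)
    rcases h2 v u (left_ne_zero_of_mul h) with h3 | h3
    · exact hu h3.symm
    · exact absurd hk (not_le.2 h3)
  · simp

theorem jordanMatrix_apply {k : ℕ} (sizes : Fin k → ℕ) (p q : Σ i, Fin (sizes i)) :
    jordanMatrix sizes p q = if p.1 = q.1 ∧ (p.2 : ℕ) + 1 = (q.2 : ℕ) then 1 else 0 := by
  obtain ⟨i, a⟩ := p
  obtain ⟨j, b⟩ := q
  rw [jordanMatrix, Matrix.blockDiagonal'_apply]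
  by_cases h : i = j
  · subst h
    simp
  · simp [h]

namespace Graph

variable {n : ℕ} {G : Graph n}

theorem toMatrix_apply (G : Graph n) (v u : Fin n) :
    G.toMatrix v u = if (u, v) ∈ G.arrows then 1 else 0 := rfl

theorem toMatrix_ne_zero {v u : Fin n} : G.toMatrix v u ≠ 0 ↔ (u, v) ∈ G.arrows := by
  simp [toMatrix_apply]

theorem y_le_height (G : Graph n) (v : Fin n) : G.y v ≤ G.height (G.x v) :=
  Finset.le_sup (f := G.y) (by simp [column])

theorem coord_eq_iff {v : Fin n} {i l : ℕ} : G.coord v = (i, l) ↔ G.x v = i ∧ G.y v = l := by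
  simp [x, y, Prod.ext_iff]

theorem exists_top {i : ℕ} (hi : 0 < G.height i) : ∃ v, G.coord v = (i, G.height i) := by
  have hne : (G.column i).Nonempty := by
    by_contra h
    rw [Finset.not_nonempty_iff_eq_empty] at h
    simp [height, h] at hi
  obtain ⟨v, hv, hv'⟩ := Finset.exists_mem_eq_sup _ hne G.y
  refine ⟨v, coord_eq_iff.2 ⟨by simpa [column] using hv, hv'.symm⟩⟩

theorem IsProperlyDownward.exists_coord_le (hG : G.IsProperlyDownward) {l : ℕ} (hl : 1 ≤ l)
    (v : Fin n) (hv : l ≤ G.y v) : ∃ w, G.coord w = (G.x v, l) := by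
  obtain ⟨d, hd⟩ := Nat.exists_eq_add_of_le hv
  induction d generalizing v with
  | zero => exact ⟨v, coord_eq_iff.2 ⟨rfl, by omega⟩⟩
  | succ d ih =>
    obtain ⟨w, hw, -⟩ := hG.2.1 v (by omega)
    obtain ⟨h1, h2⟩ := hw
    obtain ⟨u, hu⟩ := ih w (by omega) (by omega)
    exact ⟨u, by rw [hu, h1]⟩

theorem IsProperlyDownward.exists_coord (hG : G.IsProperlyDownward) {i l : ℕ} (hl : 1 ≤ l)
    (hi : l ≤ G.height i) : ∃ w, G.coord w = (i, l) := by
  obtain ⟨v, hv⟩ := exists_top (G := G) (i := i) (by omega)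
  rw [coord_eq_iff] at hv
  obtain ⟨w, hw⟩ := hG.exists_coord_le hl v (by omega)
  exact ⟨w, by rw [hw, hv.1]⟩

/-- Each arrow lowers the level by at least one. This gives nilpotency, and it also shows that the
Jordan chains end at the bottom vertices. -/
theorem IsProperlyDownward.level_of_pow_ne_zero (hG : G.IsProperlyDownward) (k : ℕ) (w u : Fin n)
    (h : (G.toMatrix ^ k) w u ≠ 0) : G.y w + k ≤ G.y u := by
  induction k generalizing u with
  | zero =>
    by_cases hwu : w = u
    · simp [hwu]
    · simp [Matrix.one_apply_ne hwu] at h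
  | succ k ih =>
    rw [pow_succ, Matrix.mul_apply] at h
    obtain ⟨z, -, hz⟩ := Finset.exists_ne_zero_of_sum_ne_zero h
    have h1 := ih z (left_ne_zero_of_mul hz)
    have h2 := hG.1 u z (toMatrix_ne_zero.1 (right_ne_zero_of_mul hz))
    omega

theorem IsProperlyDownward.isNilpotent (hG : G.IsProperlyDownward) : IsNilpotent G.toMatrix := by
  refine ⟨Finset.univ.sup G.y + 1, ?_⟩
  ext w u
  by_contra h
  have h1 := hG.level_of_pow_ne_zero _ w u h
  have h2 := Finset.le_sup (f := G.y) (Finset.mem_univ u)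
  omega

/-- Powers of the matrix map the top of a column to its lower vertices, up to vertices which are
lower or further to the right. -/
theorem IsProperlyDownward.pow_apply_top (hG : G.IsProperlyDownward) (hE : G.IsEmbedded) {i : ℕ}
    {top : Fin n} (htop : G.coord top = (i, G.height i)) (k : ℕ) (v : Fin n) (hx : G.x v = i)
    (hy : G.y v + k = G.height i) :
    (G.toMatrix ^ k) v top = 1 ∧ ∀ u, (G.toMatrix ^ k) u top ≠ 0 →
      u = v ∨ G.y u < G.y v ∨ (G.y u = G.y v ∧ G.x v < G.x u) := by
  induction k generalizing v with
  | zero =>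
    have : v = top := hE.1 _ _ (by rw [htop, coord_eq_iff]; exact ⟨hx, by omega⟩)
    subst this
    refine ⟨by simp, fun u hu => Or.inl ?_⟩
    by_contra h
    simp [Matrix.one_apply_ne h] at hu
  | succ k ih =>
    have hpos := (hE.2 v).2
    obtain ⟨v', hv'⟩ := hG.exists_coord (i := i) (l := G.y v + 1) (by omega) (by omega)
    rw [coord_eq_iff] at hv'
    obtain ⟨ih1, ih2⟩ := ih v' hv'.1 (by omega)
    obtain ⟨w, hw, harr⟩ := hG.2.1 v' (by omega)
    have : w = v := by
      refine hE.1 _ _ ?_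
      rw [show G.coord v = (G.x v, G.y v) from rfl, coord_eq_iff]
      have := hw.1
      have := hw.2
      omega
    subst this
    rw [pow_succ']
    constructor
    · rw [Matrix.mul_apply, Finset.sum_eq_single v']
      · rw [ih1, toMatrix_apply, if_pos harr, one_mul]
      · intro u _ hu
        by_contra h
        -- No other term contributes to the coefficient of `w`: a lower `u` has no level to lose,
        -- and a `u` to the right of `v'` on its level cannot send an arrow to the left by one
        -- level.
        have ha := toMatrix_ne_zero.1 (left_ne_zero_of_mul h)
        have h1 := hG.1 _ _ ha
        have h2 := hG.2.2 _ _ ha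
        rcases ih2 u (right_ne_zero_of_mul h) with h3 | h3 | h3
        · exact hu h3
        · omega
        · have := h2 (by omega)
          omega
      · simp
    · intro u hu
      rw [Matrix.mul_apply] at hu
      obtain ⟨z, -, hz⟩ := Finset.exists_ne_zero_of_sum_ne_zero hu
      have ha := toMatrix_ne_zero.1 (left_ne_zero_of_mul hz)
      have h1 := hG.1 _ _ ha
      have h2 := hG.2.2 _ _ ha
      by_cases huw : u = w
      · exact Or.inl huw
      have hne : ¬ (G.x u = G.x w ∧ G.y u = G.y w) := fun h =>
        huw (hE.1 _ _ (by rw [show G.coord w = (G.x w, G.y w) from rfl, coord_eq_iff]; exact h))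
      right
      rcases ih2 z (right_ne_zero_of_mul hz) with h3 | h3 | h3
      · subst h3
        by_cases h4 : G.y z = G.y u + 1
        · have := h2 h4
          omega
        · omega
      · omega
      · by_cases h4 : G.y z = G.y u + 1
        · have := h2 h4
          omega
        · omega

/-- Column `v` of the base change `P` is the power of the matrix, applied to the top of the column
of `v`, that descends to the level of `v`. By `pow_apply_top` it is unitriangular, and it conjugates
the matrix to the one retaining only the arrows from each vertex to the vertex below it. -/
theorem isNilpotentOfType_toMatrix (hE : G.IsEmbedded) (hG : G.IsProperlyDownward)
    {k : ℕ} {col : Fin k → ℕ} (hcol : Function.Injective col)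
    (hsurj : ∀ v, ∃ i, col i = G.x v) {lam : n.Partition}
    (hlam : Finset.univ.val.map (fun i => G.height (col i)) = lam.parts) :
    IsNilpotentOfType G.toMatrix lam := by
  have hv : ∀ p : Σ i, Fin (G.height (col i)), ∃ v, G.coord v = (col p.1, (p.2 : ℕ) + 1) :=
    fun p => hG.exists_coord (by omega) (by have := p.2.2; omega)
  choose e he using hv
  have hex : ∀ p, G.x (e p) = col p.1 := fun p => (coord_eq_iff.1 (he p)).1
  have hey : ∀ p, G.y (e p) = (p.2 : ℕ) + 1 := fun p => (coord_eq_iff.1 (he p)).2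
  have hbij : Function.Bijective e := by
    constructor
    · rintro ⟨i, a⟩ ⟨j, b⟩ h
      have h1 := hex ⟨i, a⟩
      have h2 := hey ⟨i, a⟩
      rw [h, hex] at h1
      rw [h, hey] at h2
      have : j = i := hcol h1
      subst this
      have : a = b := Fin.ext (by simpa using h2.symm)
      rw [this]
    · intro v
      obtain ⟨i, hi⟩ := hsurj v
      have h1 := G.y_le_height v
      have h2 := (hE.2 v).2
      rw [← hi] at h1
      refine ⟨⟨i, ⟨G.y v - 1, by omega⟩⟩, hE.1 _ _ ?_⟩
      rw [he]
      exact Prod.ext hi (show G.y v - 1 + 1 = G.y v by omega)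
  have htop : ∀ v, ∃ w, G.coord w = (G.x v, G.height (G.x v)) := fun v =>
    exists_top (lt_of_lt_of_le (hE.2 v).2 (G.y_le_height v))
  choose top htop using htop
  have htop' : ∀ u v, G.x u = G.x v → top u = top v := fun u v h =>
    hE.1 _ _ (by rw [htop, htop, h])
  set P : Matrix (Fin n) (Fin n) ℂ :=
    Matrix.of fun u v => (G.toMatrix ^ (G.height (G.x v) - G.y v)) u (top v) with hP
  have hPapp : ∀ v, _ := fun v => hG.pow_apply_top hE (htop v) (G.height (G.x v) - G.y v) v rfl
    (by have := G.y_le_height v; omega)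
  have hdet : P.det ≠ 0 := by
    -- Lexicographic order: level first, then position reversed, since the error terms on the same
    -- level lie further right.
    refine det_ne_zero_of_unitriangular (key := fun v => toLex (G.y v, OrderDual.toDual (G.x v)))
      (fun v => (hPapp v).1) fun u v h => ?_
    rcases (hPapp v).2 u h with h | h | h
    · exact Or.inl h
    · exact Or.inr (Prod.Lex.toLex_lt_toLex.2 (Or.inl h))
    · exact Or.inr (Prod.Lex.toLex_lt_toLex.2 (Or.inr ⟨h.1, h.2⟩))
  set E := Equiv.ofBijective e hbij with hEdef
  have hJ : ∀ z v, Matrix.reindex E E (jordanMatrix fun i => G.height (col i)) z v =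
      if G.Above v z then 1 else 0 := by
    intro z v
    obtain ⟨p, rfl⟩ := E.surjective z
    obtain ⟨q, rfl⟩ := E.surjective v
    rw [Matrix.reindex_apply, Matrix.submatrix_apply, Equiv.symm_apply_apply,
      Equiv.symm_apply_apply, jordanMatrix_apply]
    congr 1
    simp only [Above, hEdef, Equiv.ofBijective_apply, hex, hey, hcol.eq_iff, eq_iff_iff]
    constructor
    · rintro ⟨h1, h2⟩
      exact ⟨h1.symm, by omega⟩
    · rintro ⟨h1, h2⟩
      exact ⟨h1.symm, by omega⟩
  have hAP : G.toMatrix * P =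
      P * Matrix.reindex E E (jordanMatrix fun i => G.height (col i)) := by
    ext u v
    have hl : (G.toMatrix * P) u v =
        (G.toMatrix ^ (G.height (G.x v) - G.y v + 1)) u (top v) := by
      rw [pow_succ', Matrix.mul_apply, Matrix.mul_apply]
      rfl
    rw [hl, Matrix.mul_apply]
    simp only [hJ]
    have hle := G.y_le_height v
    by_cases hy : 1 < G.y v
    · obtain ⟨w, hw, -⟩ := hG.2.1 v hy
      rw [Finset.sum_eq_single w]
      · have hk : G.height (G.x v) - G.y v + 1 = G.height (G.x v) - G.y w := by
          have := hw.2
          omega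
        rw [if_pos hw, mul_one, hP, Matrix.of_apply, htop' w v hw.1.symm, ← hw.1, hk]
      · intro z _ hz
        rw [if_neg, mul_zero]
        intro hvz
        refine hz (hE.1 _ _ ?_)
        rw [show G.coord w = (G.x w, G.y w) from rfl, coord_eq_iff]
        obtain ⟨h1, h2⟩ := hvz
        obtain ⟨h3, h4⟩ := hw
        omega
      · simp
    -- A bottom vertex: one further power would land on a level below 1.
    · rw [Finset.sum_eq_zero]
      · by_contra h
        have h1 := hG.level_of_pow_ne_zero _ _ _ h
        rw [(coord_eq_iff.1 (htop v)).2] at h1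
        have h2 := (hE.2 u).2
        omega
      · intro z _
        rw [if_neg, mul_zero]
        rintro ⟨h1, h2⟩
        have h3 := (hE.2 z).2
        omega
  refine ⟨hG.isNilpotent, k, _, E, Matrix.GeneralLinearGroup.mkOfDetNeZero P hdet, hlam, ?_⟩
  set Q := Matrix.GeneralLinearGroup.mkOfDetNeZero P hdet
  have hQ : (Q : Matrix (Fin n) (Fin n) ℂ) = P := rfl
  rw [hQ, ← hAP, ← hQ, mul_assoc, Units.mul_inv, mul_one]

end Graph

end NilpotentCompletion

namespace NilpotentCompletion

/-! ### Grafting -/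

namespace Graph

variable {n r : ℕ} {G : Graph n}

theorem height_eq_of {i k : ℕ} (h1 : ∀ v, G.x v = i → G.y v ≤ k)
    (h2 : 0 < k → ∃ v, G.coord v = (i, k)) : G.height i = k := by
  apply le_antisymm
  · exact Finset.sup_le fun v hv => h1 v (by simpa [column] using hv)
  · rcases Nat.eq_zero_or_pos k with rfl | hk
    · exact Nat.zero_le _
    · obtain ⟨v, hv⟩ := h2 hk
      rw [coord_eq_iff] at hv
      have := G.y_le_height v
      rw [hv.1, hv.2] at this
      exact this

theorem height?_eq_some {i : ℕ} (hi : 0 < G.height i) : G.height? i = some (G.height i) := by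
  obtain ⟨v, hv⟩ := exists_top hi
  rw [height?, if_pos]
  exact ⟨v, by simp [column, (coord_eq_iff.1 hv).1]⟩

/-- The equation is division with remainder of `n - 1 - v` by `r`. It turns comparisons of ordinals
into comparisons of coordinates. -/
theorem ofSubdiagonal_spec (hr : 0 < r) (v : Fin n) :
    1 ≤ (ofSubdiagonal n r).x v ∧ (ofSubdiagonal n r).x v ≤ r ∧ 1 ≤ (ofSubdiagonal n r).y v ∧
      (v : ℕ) + (ofSubdiagonal n r).y v * r = n - 1 + (ofSubdiagonal n r).x v := by
  have hv := v.2
  have h1 := Nat.mod_lt (n - 1 - (v : ℕ)) hr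
  have h2 := Nat.mod_add_div (n - 1 - (v : ℕ)) r
  simp only [ofSubdiagonal, x, y]
  refine ⟨by omega, by omega, Nat.succ_pos _, ?_⟩
  rw [add_mul, one_mul, mul_comm _ r]
  omega

theorem ofSubdiagonal_coord_eq (hr : 0 < r) {v : Fin n} {j k : ℕ} (h1 : 1 ≤ j) (h2 : j ≤ r)
    (h : (v : ℕ) + k * r = n - 1 + j) : (ofSubdiagonal n r).coord v = (j, k) := by
  obtain ⟨h3, h4, h5, h6⟩ := ofSubdiagonal_spec hr v
  rw [coord_eq_iff]
  have hk : (ofSubdiagonal n r).y v = k := by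
    apply le_antisymm <;> by_contra hlt <;> rw [not_le] at hlt <;>
      have := Nat.mul_le_mul_right r hlt <;> rw [Nat.succ_mul] at this <;> omega
  refine ⟨?_, hk⟩
  rw [hk] at h6
  omega

theorem ofSubdiagonal_height (hr : 0 < r) (hrn : r < n) {j : ℕ} (h1 : 1 ≤ j) (h2 : j ≤ r) :
    (ofSubdiagonal n r).height j = (n - 1 + j) / r := by
  apply height_eq_of
  · intro v hv
    obtain ⟨h3, h4, h5, h6⟩ := ofSubdiagonal_spec hr v
    rw [Nat.le_div_iff_mul_le hr]
    omega
  · intro _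
    have hm := Nat.mod_lt (n - 1 + j) hr
    have hd := Nat.mod_add_div (n - 1 + j) r
    rw [mul_comm] at hd
    exact ⟨⟨(n - 1 + j) % r, by omega⟩, ofSubdiagonal_coord_eq hr h1 h2 hd⟩

/-- A graph obtained from that of `N_r` by grafting, with untouched columns in `U`. -/
structure IsGrafted (r : ℕ) (G : Graph n) (U : Set ℕ) : Prop where
  isEmbedded : G.IsEmbedded
  isProperlyDownward : G.IsProperlyDownward
  x_le : ∀ v, G.x v ≤ r
  mem_arrows : ∀ u v : Fin n, (v : ℕ) = u + r → (u, v) ∈ G.arrows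
  arrow_cases : ∀ u v, (u, v) ∈ G.arrows → (v : ℕ) = u + r ∨ v < u
  coord_eq : ∀ v, G.x v ∈ U ∨ (ofSubdiagonal n r).x v ∈ U →
    G.coord v = (ofSubdiagonal n r).coord v
  arrow_eq : ∀ u v, (u, v) ∈ G.arrows → G.x u ∈ U ∨ G.x v ∈ U → (v : ℕ) = u + r

/-- The top vertex of column `s` originates from a column before `t`, and its original level was
at least `l`. -/
def TopFrom (r : ℕ) (G : Graph n) (s t l : ℕ) : Prop :=
  ∀ u, G.coord u = (s, G.height s) →
    (ofSubdiagonal n r).x u < t ∧ l ≤ (ofSubdiagonal n r).y u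

theorem TopFrom.mono {s t l t' : ℕ} (h : TopFrom r G s t l) (ht : t ≤ t') :
    TopFrom r G s t' l :=
  fun u hu => ⟨(h u hu).1.trans_le ht, (h u hu).2⟩

theorem IsGrafted.mono {U V : Set ℕ} (h : IsGrafted r G U) (hV : V ⊆ U) : IsGrafted r G V where
  __ := h
  coord_eq v hv := h.coord_eq v (hv.imp (@hV _) (@hV _))
  arrow_eq u v ha hv := h.arrow_eq u v ha (hv.imp (@hV _) (@hV _))

theorem ofSubdiagonal_above_iff (hr : 0 < r) (u v : Fin n) :
    (ofSubdiagonal n r).Above u v ↔ (v : ℕ) = u + r := by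
  obtain ⟨h1, h2, h3, h4⟩ := ofSubdiagonal_spec hr u
  obtain ⟨h5, h6, h7, h8⟩ := ofSubdiagonal_spec hr v
  constructor
  · rintro ⟨h9, h10⟩
    rw [h10, Nat.succ_mul] at h4
    omega
  · intro h
    have := ofSubdiagonal_coord_eq hr (v := u) h5 h6 (k := (ofSubdiagonal n r).y v + 1)
      (by rw [Nat.succ_mul]; omega)
    exact coord_eq_iff.1 this

theorem isGrafted_ofSubdiagonal (hr : 0 < r) :
    IsGrafted r (ofSubdiagonal n r) Set.univ := by
  have hmem : ∀ u v : Fin n, (u, v) ∈ (ofSubdiagonal n r).arrows ↔ (v : ℕ) = u + r := by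
    simp [ofSubdiagonal]
  refine ⟨⟨fun u v h => ?_, fun v => ?_⟩, ⟨fun v w h => ?_, fun v hv => ?_, fun v w h _ => ?_⟩,
    fun v => (ofSubdiagonal_spec hr v).2.1, fun u v => (hmem u v).2,
    fun u v h => Or.inl ((hmem u v).1 h), fun _ _ => rfl, fun u v h _ => (hmem u v).1 h⟩
  · have h1 := (ofSubdiagonal_spec hr u).2.2.2
    have h2 := (ofSubdiagonal_spec hr v).2.2.2
    rw [show (ofSubdiagonal n r).x u = (ofSubdiagonal n r).x v from congrArg Prod.fst h,
      show (ofSubdiagonal n r).y u = (ofSubdiagonal n r).y v from congrArg Prod.snd h] at h1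
    exact Fin.ext (by omega)
  · obtain ⟨h1, -, h2, -⟩ := ofSubdiagonal_spec hr v
    exact ⟨h1, h2⟩
  · rw [hmem, ← ofSubdiagonal_above_iff hr] at h
    have := h.2
    omega
  · obtain ⟨h1, h2, h3, h4⟩ := ofSubdiagonal_spec hr v
    have h5 : 2 * r ≤ (ofSubdiagonal n r).y v * r := Nat.mul_le_mul_right r hv
    refine ⟨⟨v + r, by omega⟩, ?_⟩
    rw [ofSubdiagonal_above_iff hr, hmem]
    exact ⟨rfl, rfl⟩
  · rw [hmem, ← ofSubdiagonal_above_iff hr] at h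
    exact h.1.le

/-! ### Untouched columns, and the effect of a single graft. -/

namespace IsGrafted

variable {U : Set ℕ}

theorem x_eq (h : IsGrafted r G U) {v : Fin n} (hv : G.x v ∈ U ∨ (ofSubdiagonal n r).x v ∈ U) :
    G.x v = (ofSubdiagonal n r).x v := congrArg Prod.fst (h.coord_eq v hv)

theorem y_eq (h : IsGrafted r G U) {v : Fin n} (hv : G.x v ∈ U ∨ (ofSubdiagonal n r).x v ∈ U) :
    G.y v = (ofSubdiagonal n r).y v := congrArg Prod.snd (h.coord_eq v hv)

theorem arrow_iff_above (h : IsGrafted r G U) (hr : 0 < r) {u v : Fin n}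
    (hU : G.x u ∈ U ∨ G.x v ∈ U) : (u, v) ∈ G.arrows ↔ G.Above u v := by
  constructor
  · intro ha
    have hv := h.arrow_eq u v ha hU
    have hab := (ofSubdiagonal_above_iff hr u v).2 hv
    have huv : (G.x u ∈ U ∨ (ofSubdiagonal n r).x u ∈ U) ∧
        (G.x v ∈ U ∨ (ofSubdiagonal n r).x v ∈ U) := by
      rcases hU with hU | hU
      · refine ⟨Or.inl hU, Or.inr ?_⟩
        rwa [← hab.1, ← h.x_eq (Or.inl hU)]
      · refine ⟨Or.inr ?_, Or.inl hU⟩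
        rwa [hab.1, ← h.x_eq (Or.inl hU)]
    exact ⟨by rw [h.x_eq huv.1, h.x_eq huv.2, hab.1], by rw [h.y_eq huv.1, h.y_eq huv.2, hab.2]⟩
  · rintro ⟨hx, hy⟩
    have hu : G.x u ∈ U := by rcases hU with hU | hU; exacts [hU, hx ▸ hU]
    have hv : G.x v ∈ U := hx ▸ hu
    rw [h.x_eq (Or.inl hu), h.x_eq (Or.inl hv)] at hx
    rw [h.y_eq (Or.inl hu), h.y_eq (Or.inl hv)] at hy
    exact h.mem_arrows u v ((ofSubdiagonal_above_iff hr u v).1 ⟨hx, hy⟩)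

theorem topFrom_of_mem (h : IsGrafted r G U) {s : ℕ} (hs : s ∈ U) :
    TopFrom r G s (s + 1) (G.height s) := by
  intro u hu
  rw [coord_eq_iff] at hu
  have hm : G.x u ∈ U := hu.1 ▸ hs
  rw [← h.x_eq (Or.inl hm), ← h.y_eq (Or.inl hm), hu.1, hu.2]
  exact ⟨Nat.lt_succ_self s, le_rfl⟩

/-- Besides the new arrow, only the arrow cut between levels `G.height t - m + 1` and `G.height t -
m` of column `t` changes its shape, and `hml` handles both. The last two conclusions serve the two
continuations, in which either `s` or the rest of column `t` is the next scion. -/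
theorem graft (h : IsGrafted r G U) (hr : 0 < r) {m s t l : ℕ} (ht : t ∈ U) (hs : 0 < s)
    (hst : s < t) (hm : 0 < m) (hmt : m ≤ G.height t) (hl : l ≤ G.height s)
    (hml : G.height t - m + 1 ≤ max 1 l) (htop : TopFrom r G s t l) :
    ∃ G', G.graft m t s = some G' ∧ IsGrafted r G' (U \ {s, t}) ∧
      G'.height = Function.update (Function.update G.height t (G.height t - m)) s
        (G.height s + m) ∧
      TopFrom r G' s (t + 1) (G.height t) ∧ TopFrom r G' t (t + 1) (G.height t - m) := by
  obtain ⟨hE, hD, hxr, hsub, hcases, hcoord, harrow⟩ := id h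
  have hpath : G.IsDownwardPath t := fun v hv w =>
    ⟨h.arrow_iff_above hr (Or.inl (hv ▸ ht)), h.arrow_iff_above hr (Or.inr (hv ▸ ht))⟩
  have hcan : G.CanGraft m t s := ⟨hE, hD, hpath, hs, hst, hm, hmt⟩
  set b := G.height t - m with hb
  obtain ⟨G', hG', harr, hmoved, hfixed⟩ : ∃ G', G.graft m t s = some G' ∧
      (∀ u w, (u, w) ∈ G'.arrows ↔ (u, w) ∈ G.arrows ∨
        (G.x u = t ∧ G.y u = b + 1) ∧ (G.x w = s ∧ G.y w = G.height s)) ∧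
      (∀ v, G.x v = t → b < G.y v → G'.x v = s ∧ G'.y v = G.height s + (G.y v - b)) ∧
      (∀ v, ¬ (G.x v = t ∧ b < G.y v) → G'.x v = G.x v ∧ G'.y v = G.y v) := by
    rw [Graph.graft, if_pos hcan]
    refine ⟨_, rfl, fun u w => ?_, fun v h1 h2 => ?_, fun v h1 => ?_⟩
    · simp [coord_eq_iff, hb]
    · rw [← coord_eq_iff]
      simp only
      rw [if_pos ⟨h1, h2⟩]
    · rw [← coord_eq_iff]
      simp only
      rw [if_neg h1]
      rfl
  refine ⟨G', hG', ?_⟩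
  have hbelow : ∀ u w, (u, w) ∈ G.arrows → G.x u = t ∨ G.x w = t → G.Above u w := by
    intro u w ha hu
    rw [← h.arrow_iff_above hr (hu.imp (· ▸ ht) (· ▸ ht))]
    exact ha
  have hyle : ∀ v i, G.x v = i → G.y v ≤ G.height i := fun v i hv => hv ▸ G.y_le_height v
  have hE' : G'.IsEmbedded := by
    constructor
    · intro u v huv
      rw [show G'.coord v = (G'.x v, G'.y v) from rfl, coord_eq_iff] at huv
      refine hE.1 u v ?_
      rw [show G.coord v = (G.x v, G.y v) from rfl, coord_eq_iff]
      by_cases hu : G.x u = t ∧ b < G.y u <;> by_cases hv : G.x v = t ∧ b < G.y v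
      · have h1 := hmoved u hu.1 hu.2
        have h2 := hmoved v hv.1 hv.2
        omega
      · have h1 := hmoved u hu.1 hu.2
        have h2 := hfixed v hv
        have h3 := hyle v s (by omega)
        omega
      · have h1 := hfixed u hu
        have h2 := hmoved v hv.1 hv.2
        have h3 := hyle u s (by omega)
        omega
      · have h1 := hfixed u hu
        have h2 := hfixed v hv
        omega
    · intro v
      have h0 := hE.2 v
      by_cases hv : G.x v = t ∧ b < G.y v
      · have h1 := hmoved v hv.1 hv.2
        omega
      · have h1 := hfixed v hv
        omega
  have hD' : G'.IsProperlyDownward := by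
    refine ⟨fun u w ha => ?_, fun v hv => ?_, fun u w ha hy => ?_⟩
    · rcases (harr u w).1 ha with ha | ⟨hu, hw⟩
      · have h0 := hD.1 u w ha
        by_cases hu : G.x u = t ∧ b < G.y u
        · obtain ⟨hx, hy⟩ := hbelow u w ha (Or.inl hu.1)
          have h1 := hmoved u hu.1 hu.2
          by_cases hw : G.x w = t ∧ b < G.y w
          · have h2 := hmoved w hw.1 hw.2
            omega
          · have h2 := hfixed w hw
            -- The cut arrow now starts at level `G.height s + 1`, while `w` stays at level `b`. It
            -- still descends, since `b < G.height s`; for `l ≤ 1` there is no such `w`, because `b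
            -- = 0`.
            have : max 1 l ≤ max 1 (G.height s) := max_le_max le_rfl hl
            rcases le_total l 1 with hl1 | hl1
            · rw [max_eq_left hl1] at hml
              have := (hE.2 w).2
              omega
            · rw [max_eq_right hl1] at hml
              omega
        · have h1 := hfixed u hu
          by_cases hw : G.x w = t ∧ b < G.y w
          · have := hbelow u w ha (Or.inr hw.1)
            exact absurd ⟨this.1.trans hw.1, by omega⟩ hu
          · have h2 := hfixed w hw
            omega
      · have h1 := hmoved u hu.1 (by omega)
        have h2 := hfixed w (by omega)
        omega
    · by_cases hv' : G.x v = t ∧ b < G.y v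
      · have h1 := hmoved v hv'.1 hv'.2
        by_cases hvb : G.y v = b + 1
        · obtain ⟨w, hw⟩ := exists_top (G := G) (i := s) (by omega)
          rw [coord_eq_iff] at hw
          have h2 := hfixed w (by omega)
          exact ⟨w, ⟨by omega, by omega⟩, (harr v w).2 (Or.inr ⟨⟨hv'.1, hvb⟩, hw⟩)⟩
        · obtain ⟨w, ⟨hx, hy⟩, hw⟩ := hD.2.1 v (by omega)
          have h2 := hmoved w (by omega) (by omega)
          exact ⟨w, ⟨by omega, by omega⟩, (harr v w).2 (Or.inl hw)⟩
      · have h1 := hfixed v hv'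
        obtain ⟨w, ⟨hx, hy⟩, hw⟩ := hD.2.1 v (by omega)
        have h2 := hfixed w (by omega)
        exact ⟨w, ⟨by omega, by omega⟩, (harr v w).2 (Or.inl hw)⟩
    · rcases (harr u w).1 ha with ha | ⟨hu, hw⟩
      · have h0 := hD.2.2 u w ha
        by_cases hu : G.x u = t ∧ b < G.y u
        · obtain ⟨hx, hy'⟩ := hbelow u w ha (Or.inl hu.1)
          have h1 := hmoved u hu.1 hu.2
          by_cases hw : G.x w = t ∧ b < G.y w
          · have h2 := hmoved w hw.1 hw.2
            omega
          · have h2 := hfixed w hw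
            omega
        · have h1 := hfixed u hu
          by_cases hw : G.x w = t ∧ b < G.y w
          · have := hbelow u w ha (Or.inr hw.1)
            have h3 := hD.1 u w ha
            exact absurd ⟨this.1.trans hw.1, by omega⟩ hu
          · have h2 := hfixed w hw
            have := h0 (by omega)
            omega
      · have h1 := hmoved u hu.1 (by omega)
        have h2 := hfixed w (by omega)
        omega
  have hU : ∀ v, G'.x v ∈ U \ {s, t} → ¬ (G.x v = t ∧ b < G.y v) := by
    intro v hv hv'
    have h1 := hmoved v hv'.1 hv'.2
    exact hv.2 (by simp [h1.1])
  have hheight : G'.height = Function.update (Function.update G.height t b) s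
      (G.height s + m) := by
    funext i
    by_cases his : i = s
    · subst his
      rw [Function.update_self]
      apply height_eq_of
      · intro v hv
        by_cases hv' : G.x v = t ∧ b < G.y v
        · have h1 := hmoved v hv'.1 hv'.2
          have h2 := hyle v t hv'.1
          omega
        · have h1 := hfixed v hv'
          have h2 := hyle v i (by omega)
          omega
      · intro _
        obtain ⟨v, hv⟩ := exists_top (G := G) (i := t) (by omega)
        rw [coord_eq_iff] at hv
        have h1 := hmoved v hv.1 (by omega)
        refine ⟨v, ?_⟩
        rw [coord_eq_iff]
        omega
    · rw [Function.update_of_ne his]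
      by_cases hit : i = t
      · subst hit
        rw [Function.update_self]
        apply height_eq_of
        · intro v hv
          by_cases hv' : G.x v = i ∧ b < G.y v
          · have h1 := hmoved v hv'.1 hv'.2
            omega
          · have h1 := hfixed v hv'
            omega
        · intro hb0
          obtain ⟨v, hv⟩ := hD.exists_coord (i := i) (l := b) (by omega) (by omega)
          rw [coord_eq_iff] at hv
          have h1 := hfixed v (by omega)
          refine ⟨v, ?_⟩
          rw [coord_eq_iff]
          omega
      · rw [Function.update_of_ne hit]
        apply height_eq_of
        · intro v hv
          by_cases hv' : G.x v = t ∧ b < G.y v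
          · have h1 := hmoved v hv'.1 hv'.2
            omega
          · have h1 := hfixed v hv'
            have h2 := hyle v i (by omega)
            omega
        · intro hi
          obtain ⟨v, hv⟩ := exists_top hi
          rw [coord_eq_iff] at hv
          have h1 := hfixed v (by omega)
          refine ⟨v, ?_⟩
          rw [coord_eq_iff]
          omega
  refine ⟨⟨hE', hD', fun v => ?_, fun u v huv => (harr u v).2 (Or.inl (hsub u v huv)),
    fun u w ha => ?_, fun v hv => ?_, fun u w ha huw => ?_⟩, hheight, fun v hv => ?_,
    fun v hv => ?_⟩
  · have h0 := hxr v
    by_cases hv : G.x v = t ∧ b < G.y v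
    · have h1 := hmoved v hv.1 hv.2
      omega
    · have h1 := hfixed v hv
      omega
  · rcases (harr u w).1 ha with ha | ⟨hu, hw⟩
    · exact hcases u w ha
    -- The new arrow: the original level of `w` is at least `b + 1` and its original column precedes
    -- `t`, so its ordinal is smaller than that of `u`.
    · right
      have h1 := htop w (coord_eq_iff.2 hw)
      have h2 := ofSubdiagonal_spec hr u
      have h3 := ofSubdiagonal_spec hr w
      have hmem : G.x u ∈ U := hu.1 ▸ ht
      rw [← h.x_eq (Or.inl hmem), ← h.y_eq (Or.inl hmem), hu.1, hu.2] at h2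
      have h4 : b + 1 ≤ (ofSubdiagonal n r).y w := hml.trans (max_le h3.2.2.1 h1.2)
      have h5 := Nat.mul_le_mul_right r h4
      rw [Fin.lt_def]
      omega
  · have hv' : ¬ (G.x v = t ∧ b < G.y v) := by
      rcases hv with hv | hv
      · exact hU v hv
      · intro hv'
        rw [h.x_eq (Or.inl (hv'.1 ▸ ht))] at hv'
        exact hv.2 (by simp [hv'.1])
    have h1 := hfixed v hv'
    rw [← hcoord v (by rw [h1.1] at hv; exact hv.imp (·.1) (·.1))]
    exact coord_eq_iff.2 h1
  · rcases (harr u w).1 ha with ha | ⟨hu, hw⟩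
    · refine harrow u w ha ?_
      rcases huw with hu | hw
      · have h1 := hfixed u (hU u hu)
        exact Or.inl (h1.1 ▸ hu.1)
      · have h1 := hfixed w (hU w hw)
        exact Or.inr (h1.1 ▸ hw.1)
    · exfalso
      rcases huw with hu' | hw'
      · have h1 := hmoved u hu.1 (by omega)
        exact hu'.2 (by simp [h1.1])
      · have h1 := hfixed w (by omega)
        exact hw'.2 (by simp [h1.1, hw.1])
  · rw [coord_eq_iff, hheight, Function.update_self] at hv
    have hv' : G.x v = t ∧ b < G.y v := by
      by_contra hv'
      have h1 := hfixed v hv'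
      have h2 := hyle v s (by omega)
      omega
    have h1 := hmoved v hv'.1 hv'.2
    have hmem : G.x v ∈ U := hv'.1 ▸ ht
    have h2 := h.x_eq (Or.inl hmem)
    have h3 := h.y_eq (Or.inl hmem)
    omega
  · rw [coord_eq_iff, hheight, Function.update_of_ne hst.ne', Function.update_self] at hv
    have hv' : ¬ (G.x v = t ∧ b < G.y v) := by
      intro hv'
      have h1 := hmoved v hv'.1 hv'.2
      omega
    have h1 := hfixed v hv'
    have hmem : G.x v ∈ U := by rw [← h1.1, hv.1]; exact ht
    have h2 := h.x_eq (Or.inl hmem)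
    have h3 := h.y_eq (Or.inl hmem)
    omega

end IsGrafted

end Graph

end NilpotentCompletion

namespace NilpotentCompletion

/-! ### The partially grafted graph during the algorithm -/

/-- The multiset with the only element `k`, or the empty multiset if `k` is zero. -/
def part (k : ℕ) : Multiset ℕ := if k = 0 then 0 else {k}

theorem part_zero : part 0 = 0 := rfl

theorem part_of_pos {k : ℕ} (hk : 0 < k) : part k = {k} := if_neg hk.ne'

/-- The multiset of the nonzero values of `h` on the columns `1, …, r`. -/
def columnParts (r : ℕ) (h : ℕ → ℕ) : Multiset ℕ := ∑ j ∈ Finset.Icc 1 r, part (h j)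

/-- The old value is moved to the other side to avoid subtracting multisets. -/
theorem columnParts_update {r : ℕ} (h : ℕ → ℕ) {s : ℕ} (hs : s ∈ Finset.Icc 1 r) (a : ℕ) :
    columnParts r (Function.update h s a) + part (h s) = columnParts r h + part a := by
  rw [columnParts, columnParts, ← Finset.add_sum_erase _ _ hs, ← Finset.add_sum_erase _ _ hs,
    Function.update_self, Finset.sum_congr rfl fun j hj => by
      rw [Function.update_of_ne (Finset.ne_of_mem_erase hj)]]
  abel

theorem sum_Icc_eq_add {M : Type*} [AddCommMonoid M] (F : ℕ → M) {t e : ℕ} (h : t ≤ e) :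
    ∑ j ∈ Finset.Icc t e, F j = F t + ∑ j ∈ Finset.Icc (t + 1) e, F j := by
  rw [← Finset.sum_insert (by simp)]
  congr 1
  ext j
  simp
  omega

variable {n r e : ℕ} {H : ℕ → ℕ} {G : Graph n} {s t l : ℕ} {P : Multiset ℕ}

/-- The columns `t, …, e` are untouched with heights given by `H`, column `s` is under construction,
and the other columns have the heights in `P`. -/
structure InProgress (r e : ℕ) (H : ℕ → ℕ) (G : Graph n) (s t l : ℕ) (P : Multiset ℕ) :
    Prop where
  isGrafted : G.IsGrafted r (Set.Ici t)
  topFrom : G.TopFrom r s t l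
  le_height : l ≤ G.height s
  scion_pos : 0 < s
  scion_lt : s < t
  scion_le : s ≤ e
  stock_le : t ≤ e + 1
  le_card : e ≤ r
  height_eq : ∀ j, t ≤ j → j ≤ e → G.height j = H j
  columnParts_eq :
    columnParts r G.height = P + part (G.height s) + ∑ j ∈ Finset.Icc t e, part (H j)

/-- The graph is the result of grafting and its columns have the heights in `P`. -/
def IsFinished (r : ℕ) (G : Graph n) (P : Multiset ℕ) : Prop :=
  (∃ U, G.IsGrafted r U) ∧ columnParts r G.height = P

namespace InProgress

theorem finish (h : InProgress r e H G s (e + 1) l P) :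
    IsFinished r G (P + part (G.height s)) := by
  refine ⟨⟨_, h.isGrafted⟩, ?_⟩
  rw [h.columnParts_eq]
  simp

/-- The scion is declared finished and the intact column `t` takes its place; its own height serves
as the new `l`. -/
theorem advance (h : InProgress r e H G s t l P) (ht : t ≤ e) :
    InProgress r e H G t (t + 1) (H t) (P + part (G.height s)) where
  isGrafted := h.isGrafted.mono (Set.Ici_subset_Ici.2 (Nat.le_succ t))
  topFrom := by
    rw [← h.height_eq t le_rfl ht]
    exact h.isGrafted.topFrom_of_mem Set.self_mem_Ici
  le_height := (h.height_eq t le_rfl ht).ge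
  scion_pos := h.scion_pos.trans h.scion_lt
  scion_lt := Nat.lt_succ_self t
  scion_le := ht
  stock_le := by omega
  le_card := h.le_card
  height_eq j hj := h.height_eq j (by omega)
  columnParts_eq := by
    rw [h.columnParts_eq, sum_Icc_eq_add _ ht, h.height_eq t le_rfl ht]
    abel

/-- One graft, two continuations: either the rest of column `t` is a finished part and `s` keeps
growing, or `s` is finished and the rest of column `t` becomes the scion. -/
theorem graft (h : InProgress r e H G s t l P) (hr : 0 < r) (ht : t ≤ e) {k : ℕ} (hk : 0 < k)
    (hkt : k ≤ H t) (hkl : H t - k + 1 ≤ max 1 l) :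
    ∃ G', G.graft k t s = some G' ∧
      (G'.height s = G.height s + k ∧
        InProgress r e H G' s (t + 1) (H t) (P + part (H t - k))) ∧
      (G'.height t = H t - k ∧
        InProgress r e H G' t (t + 1) (H t - k) (P + part (G.height s + k))) := by
  have hH := h.height_eq t le_rfl ht
  have hst := h.scion_lt
  have hle := h.le_height
  have hs0 := h.scion_pos
  have her := h.le_card
  obtain ⟨G', hG', hgr, hheight, htop, htop'⟩ := h.isGrafted.graft hr Set.self_mem_Ici
    h.scion_pos hst hk (hH ▸ hkt) hle (hH ▸ hkl) h.topFrom
  have hs : G'.height s = G.height s + k := by rw [hheight, Function.update_self]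
  have ht' : G'.height t = H t - k := by
    rw [hheight, Function.update_of_ne hst.ne', Function.update_self, hH]
  have hgr' : G'.IsGrafted r (Set.Ici (t + 1)) := hgr.mono fun j hj => by
    simp only [Set.mem_Ici] at hj
    simp
    omega
  have hj : ∀ j, t + 1 ≤ j → j ≤ e → G'.height j = H j := by
    intro j h1 h2
    rw [hheight, Function.update_of_ne (by omega), Function.update_of_ne (by omega)]
    exact h.height_eq j (by omega) h2
  have hparts : columnParts r G'.height = P + part (H t - k) + part (G.height s + k) +
      ∑ j ∈ Finset.Icc (t + 1) e, part (H j) := by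
    have h1 := columnParts_update (r := r) (Function.update G.height t (H t - k)) (s := s)
      (by simp; omega) (G.height s + k)
    have h2 := columnParts_update (r := r) G.height (s := t) (by simp; omega) (H t - k)
    rw [Function.update_of_ne hst.ne] at h1
    rw [h.columnParts_eq, sum_Icc_eq_add _ ht, hH] at h2
    rw [hheight, hH]
    apply add_right_cancel (b := part (G.height s) + part (H t))
    rw [← add_assoc, h1, add_right_comm, h2]
    abel
  rw [hH] at htop htop'
  refine ⟨G', hG', ⟨hs, hgr', htop, by omega, hs0, by omega, h.scion_le, by omega, her, hj, ?_⟩,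
    ⟨ht', hgr', htop', ht'.ge, by omega, by omega, ht, by omega, her, hj, ?_⟩⟩
  · rw [hparts, hs]
  · rw [hparts, ht']
    abel

/-- For cases (1a) and (2a): column `t` is skipped and becomes the next scion, while `s` and the
rest of column `t + 1` are finished. -/
theorem graft_next (h : InProgress r e H G s t l P) (hr : 0 < r) (ht : t + 1 ≤ e) {k : ℕ}
    (hk : 0 < k) (hkt : k ≤ H (t + 1)) (hkl : H (t + 1) - k + 1 ≤ max 1 l) :
    ∃ G', G.graft k (t + 1) s = some G' ∧ G'.height t = H t ∧
      InProgress r e H G' t (t + 2) (H t)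
        (P + part (G.height s + k) + part (H (t + 1) - k)) := by
  have hH := h.height_eq t le_rfl (by omega)
  have hH' := h.height_eq (t + 1) (by omega) ht
  have hst := h.scion_lt
  have hs0 := h.scion_pos
  have her := h.le_card
  obtain ⟨G', hG', hgr, hheight, -, -⟩ := h.isGrafted.graft (t := t + 1) hr
    (by simp) h.scion_pos (by omega) hk (hH' ▸ hkt) h.le_height (hH' ▸ hkl)
    (h.topFrom.mono (Nat.le_succ t))
  have ht' : G'.height t = H t := by
    rw [hheight, Function.update_of_ne hst.ne', Function.update_of_ne (by omega), hH]
  refine ⟨G', hG', ht', hgr.mono fun j hj => ?_, ?_, ht'.ge, by omega, by omega, by omega,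
    by omega, her, fun j h1 h2 => ?_, ?_⟩
  · simp only [Set.mem_Ici] at hj
    simp
    omega
  · rw [← ht']
    refine (hgr.topFrom_of_mem (s := t) ?_).mono (Nat.le_succ _)
    simp
    omega
  · rw [hheight, Function.update_of_ne (by omega), Function.update_of_ne (by omega)]
    exact h.height_eq j (by omega) h2
  · have h1 := columnParts_update (r := r) (Function.update G.height (t + 1) (H (t + 1) - k))
      (s := s) (by simp; omega) (G.height s + k)
    have h2 := columnParts_update (r := r) G.height (s := t + 1) (by simp; omega) (H (t + 1) - k)
    rw [Function.update_of_ne (by omega)] at h1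
    rw [h.columnParts_eq, sum_Icc_eq_add _ (by omega : t ≤ e), sum_Icc_eq_add _ ht, hH'] at h2
    rw [ht', hheight, hH']
    apply add_right_cancel (b := part (G.height s) + part (H (t + 1)))
    rw [← add_assoc, h1, add_right_comm, h2]
    abel

end InProgress

end NilpotentCompletion

namespace NilpotentCompletion

/-! ### Correctness of the loops -/

/-- The column heights `H` take only the values `f` and `c`, in this order, on `1, …, e`. -/
structure IsProfile (e f c : ℕ) (H : ℕ → ℕ) : Prop where
  pos : 0 < f
  le : f ≤ c
  le_succ : c ≤ f + 1
  eq_or : ∀ j, 1 ≤ j → j ≤ e → H j = f ∨ H j = c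
  mono : ∀ i j, 1 ≤ i → i ≤ j → j ≤ e → H i ≤ H j

variable {n r e f c : ℕ} {H : ℕ → ℕ} {G : Graph n} {s t l : ℕ} {P : Multiset ℕ}
  {lam : Multiset ℕ} {S : State n}

/-- The invariant common to both loops. -/
structure Invariant (r e : ℕ) (H : ℕ → ℕ) (lam : Multiset ℕ) (S : State n) (l : ℕ)
    (P : Multiset ℕ) : Prop where
  inProgress : InProgress r e H S.graph S.scion S.stock l P
  parts_eq : lam = P + S.long + S.short
  sum_eq : S.graph.height S.scion + ∑ j ∈ Finset.Icc S.stock e, H j = S.long.sum + S.short.sum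
  lt_long : ∀ x ∈ S.long, H e < x
  -- The second inequality is the level condition for grafting `M - h(s)` vertices from column
  -- `stock`, rearranged without subtraction.
  reach : ∀ M ∈ S.long, (∀ x ∈ S.long, x ≤ M) →
    S.graph.height S.scion < M ∧
      (S.stock ≤ e → H S.stock + 1 + S.graph.height S.scion ≤ l + M)

/-- The invariant of Loop 1. -/
structure Invariant₁ (r e : ℕ) (H : ℕ → ℕ) (lam : Multiset ℕ) (S : State n) (l : ℕ)
    (P : Multiset ℕ) : Prop extends Invariant r e H lam S l P where
  -- The right side counts the remaining columns: the scion and `stock, …, e`.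
  card_le : S.long.card + S.short.card ≤ 1 + (e + 1 - S.stock)
  -- The bound by `l` permits cutting a column down to `x`.
  short : ∀ x ∈ S.short, 0 < x ∧ x < H S.scion ∧ x < S.graph.height S.scion ∧ x < l

/-- All parts have been made. -/
def IsComplete (r : ℕ) (lam : Multiset ℕ) (S : State n) : Prop :=
  S.long = 0 ∧ S.short = 0 ∧ IsFinished r S.graph lam

theorem max?_cons {M : ℕ} {L : Multiset ℕ} (h : ∀ x ∈ L, x ≤ M) : max? (M ::ₘ L) = some M := by
  rw [max?, if_neg (Multiset.cons_ne_zero), Multiset.sup_cons, sup_eq_left.2]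
  exact Multiset.sup_le.2 h

theorem exists_cons_max {L : Multiset ℕ} (h : L ≠ 0) : ∃ M L', L = M ::ₘ L' ∧ ∀ x ∈ L', x ≤ M := by
  obtain ⟨M, hM, hmax⟩ := Finset.exists_max_image L.toFinset id (by simpa using h)
  simp only [Multiset.mem_toFinset, id] at hM hmax
  obtain ⟨L', rfl⟩ := Multiset.exists_cons_of_mem hM
  exact ⟨M, L', rfl, fun x hx => hmax x (Multiset.mem_cons_of_mem hx)⟩

theorem cons_sub_singleton (M : ℕ) (L : Multiset ℕ) : (M ::ₘ L) - {M} = L := by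
  rw [Multiset.sub_singleton, Multiset.erase_cons_head]

theorem eq_zero_of_sum_eq_zero {L : Multiset ℕ} (h : ∀ x ∈ L, 0 < x) (hs : L.sum = 0) : L = 0 := by
  by_contra hne
  obtain ⟨x, hx⟩ := Multiset.exists_mem_of_ne_zero hne
  have := Multiset.le_sum_of_mem hx
  have := h x hx
  omega

/-- When the top of a fresh scion sits at its original level, `h` and `l` cancel in `reach`, and
what remains follows from `H t ≤ H e < M`. -/
theorem reach_of_eq {L : Multiset ℕ} {h t e l : ℕ} (hH : IsProfile e f c H) (ht : 1 ≤ t)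
    (hL : ∀ x ∈ L, H e < x) (hl : h = l) (he : h ≤ H e) (M : ℕ) (hM : M ∈ L) :
    h < M ∧ (t ≤ e → H t + 1 + h ≤ l + M) := by
  have h1 := hL M hM
  refine ⟨by omega, fun hte => ?_⟩
  have h2 := hH.mono t e ht hte le_rfl
  omega

/-- Without long parts, each remaining part is less than each remaining height, and there are at
least as many columns as parts; so the sums could not agree. -/
theorem Invariant₁.long_ne_zero (hH : IsProfile e f c H) (h : Invariant₁ r e H lam S l P)
    (hS : S.short ≠ 0) : S.long ≠ 0 := by
  intro hL
  obtain ⟨m, S', hS', hmax⟩ := exists_cons_max hS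
  have hmS : m ∈ S.short := by simp [hS']
  have hm := h.short m hmS
  have h1 := h.sum_eq
  have h2 := h.card_le
  have hs1 := h.inProgress.scion_pos
  have hst := h.inProgress.scion_lt
  have hte := h.inProgress.stock_le
  have h3 : S.short.sum ≤ S.short.card • m := Multiset.sum_le_card_nsmul _ _ fun x hx => by
    rw [hS', Multiset.mem_cons] at hx
    rcases hx with rfl | hx
    exacts [le_rfl, hmax x hx]
  have h4 : (Finset.Icc S.stock e).card • m ≤ ∑ j ∈ Finset.Icc S.stock e, H j :=
    Finset.card_nsmul_le_sum _ _ _ fun j hj => by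
      rw [Finset.mem_Icc] at hj
      have := hH.mono S.scion j (by omega) (by omega) hj.2
      omega
  rw [hL] at h1 h2
  simp only [Multiset.card_zero, Multiset.sum_zero, smul_eq_mul, Nat.card_Icc, zero_add] at *
  have h5 := Nat.mul_le_mul_right m h2
  rw [add_mul] at h5
  omega

theorem loop1Body_spec (hr : 0 < r) (hH : IsProfile e f c H) (h : Invariant₁ r e H lam S l P)
    (hS : S.short ≠ 0) :
    ∃ T, loop1Body S = some T ∧ T.long.card + T.short.card < S.long.card + S.short.card ∧
      ((∃ l P, Invariant₁ r e H lam T l P) ∨ IsComplete r lam T) := by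
  have hL := h.long_ne_zero hH hS
  obtain ⟨G, s, t, L, Sh⟩ := S
  simp only at hS hL
  obtain ⟨M, L, rfl, hMmax⟩ := exists_cons_max hL
  obtain ⟨m, Sh, rfl, hmmax⟩ := exists_cons_max hS
  obtain ⟨⟨hcore, hparts, hsum, hlong, hreach⟩, hcard, hshort⟩ := h
  simp only at hcore hparts hsum hlong hreach hcard hshort
  have hs1 := hcore.scion_pos
  have hst := hcore.scion_lt
  have hreachM := hreach M (Multiset.mem_cons_self _ _) fun x hx => by
    rcases Multiset.mem_cons.1 hx with rfl | hx
    exacts [le_rfl, hMmax x hx]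
  have hshortm := hshort m (Multiset.mem_cons_self _ _)
  simp only [Multiset.card_cons] at hcard
  have hte : t ≤ e := by omega
  have hreach2 := hreachM.2 hte
  simp only [Multiset.sum_cons, sum_Icc_eq_add _ hte] at hsum
  have hlong' : ∀ x ∈ L, H e < x := fun x hx => hlong x (Multiset.mem_cons_of_mem hx)
  have hHm := fun i j h1 h2 h3 => hH.mono i j h1 h2 h3
  have hst' := hHm s t (by omega) (by omega) hte
  have htt := hHm t e (by omega) hte le_rfl
  have hhM := max?_cons hMmax
  have hhm := max?_cons hmmax
  have hHt := hcore.height_eq t le_rfl hte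
  have hht : G.height? t = some (H t) := by
    rw [← hHt]
    exact Graph.height?_eq_some (by omega)
  -- The remaining heights sum to at least `M + m`, so those of `s` and `t` alone do not suffice.
  have hsum' : M + m = G.height s + H t + 1 → t + 1 ≤ e := by
    intro h1
    by_contra h2
    rw [Finset.Icc_eq_empty (by omega), Finset.sum_empty] at hsum
    omega
  have hht' : t + 1 ≤ e → G.height? (t + 1) = some (H (t + 1)) := by
    intro h1
    have h2 := hcore.height_eq (t + 1) (by omega) h1
    have h3 := hHm t (t + 1) (by omega) (by omega) h1
    rw [← h2]
    exact Graph.height?_eq_some (by omega)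
  have hle1 : ∀ x : ℕ, x ≤ l → x ≤ max 1 l := fun x hx => hx.trans (le_max_right _ _)
  unfold loop1Body
  simp only [hhM, hhm, hht, Option.bind_eq_bind, Option.bind_some, cons_sub_singleton]
  -- Case (1a): `H t = f` and `H (t + 1) = c = f + 1`, so column `t + 1` splits exactly into what
  -- `M` lacks and `m`.
  by_cases ha : M + m = G.height s + H t + 1 ∧ H t < H (t + 1)
  · have hte' := hsum' ha.1
    have hHt' := hcore.height_eq (t + 1) (by omega) hte'
    have hc1 := hH.eq_or t (by omega) hte
    have hc2 := hH.eq_or (t + 1) (by omega) hte'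
    have hc3 := hH.le_succ
    have hc5 := hH.le
    have hc4 := hHm (t + 1) e (by omega) hte' le_rfl
    obtain ⟨G', hG', hh, hcore'⟩ := hcore.graft_next hr hte' (k := H (t + 1) - m) (by omega)
      (by omega) (hle1 _ (by omega))
    rw [if_pos (by omega), hht' hte', Option.map_some, Option.bind_some,
      if_pos (by simpa using ha.2), hHt', hG', Option.bind_some]
    rw [sum_Icc_eq_add _ hte'] at hsum
    rw [show H (t + 1) - (H (t + 1) - m) = m by omega,
      show G.height s + (H (t + 1) - m) = M by omega, part_of_pos (by omega),
      part_of_pos (by omega)] at hcore'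
    refine ⟨_, rfl, by simp; omega, Or.inl ⟨_, _, ⟨hcore', ?_, ?_, hlong', fun M' hM' _ => ?_⟩, ?_,
      fun x hx => ?_⟩⟩
    · rw [hparts, ← Multiset.singleton_add, ← Multiset.singleton_add]
      abel
    · simp only [hh]
      rw [add_assoc t 1 1, one_add_one_eq_two] at hsum
      omega
    · exact reach_of_eq hH (by simp) hlong' hh (by rw [hh]; exact htt) M' hM'
    · simp only
      omega
    · have h1 := hshort x (Multiset.mem_cons_of_mem hx)
      simp only [hh]
      omega
  -- The guard of (1a) is well defined and false: if its first equality holds, column `t + 1` exists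
  -- by `hsum'`.
  · have hcase : ∀ A A' X : Option (State n),
        (if (M : ℤ) - G.height s = (H t : ℤ) - m + 1 then
          ((G.height? (t + 1)).map fun hs' => decide (H t < hs')).bind fun b =>
            if b = true then A else X
        else if false = true then A' else X) = X := by
      intro A A' X
      rw [if_neg (by simp : ¬ (false = true))]
      split_ifs with h1
      · have h2 := hsum' (by omega)
        rw [hht' h2, Option.map_some, Option.bind_some, if_neg]
        simp only [decide_eq_true_eq]
        intro h3
        exact ha ⟨by omega, h3⟩
      · rfl
    rw [hcase]
    by_cases hb : G.height s + H t < M + m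
    · rw [if_pos (by omega)]
      obtain ⟨G', hG', ⟨hh, hcore'⟩, -⟩ := hcore.graft hr hte (k := H t - m) (by omega)
        (by omega) (hle1 _ (by omega))
      rw [hG', Option.bind_some]
      rw [show H t - (H t - m) = m by omega, part_of_pos (by omega)] at hcore'
      refine ⟨_, rfl, by simp, Or.inl ⟨_, _, ⟨hcore', ?_, ?_, hlong, fun M' hM' hmax => ?_⟩, ?_,
        fun x hx => ?_⟩⟩
      · rw [hparts, ← Multiset.singleton_add m]
        abel
      · simp only [hh, Multiset.sum_cons]
        omega
      · have h1 := hmax M (Multiset.mem_cons_self _ _)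
        simp only [hh]
        -- With the new `l = H t`, `reach` could fail only if the scion were one short of `M` and `H
        -- (t + 1) = H t + 1`, which is the excluded case (1a).
        refine ⟨by omega, fun h2 => ?_⟩
        have hc1 := hH.eq_or t (by omega) hte
        have hc2 := hH.eq_or (t + 1) (by omega) h2
        have hc3 := hH.le_succ
        have hc4 := hH.le
        have hc5 := hHm t (t + 1) (by omega) (by omega) h2
        omega
      · simp only [Multiset.card_cons]
        omega
      · have h1 := hshort x (Multiset.mem_cons_of_mem hx)
        simp only [hh]
        omega
    · rw [if_neg (by omega)]
      by_cases hc : G.height s + H t = M + m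
      · rw [if_pos (by omega)]
        obtain ⟨G', hG', ⟨hh, hcore'⟩, -⟩ := hcore.graft hr hte (k := H t - m) (by omega)
          (by omega) (hle1 _ (by omega))
        rw [hG', Option.bind_some]
        rw [show H t - (H t - m) = m by omega, part_of_pos (by omega)] at hcore'
        refine ⟨_, rfl, by simp; omega, ?_⟩
        have hM' : part (G'.height s) = {M} := by
          rw [hh, show G.height s + (H t - m) = M by omega, part_of_pos (by omega)]
        -- If `t` was the last column, the new pointers lie beyond `e` and the invariant is
        -- meaningless, but equality of the sums shows that nothing is left to make.
        by_cases hte' : t + 1 ≤ e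
        · have hHt' := hcore'.height_eq (t + 1) le_rfl hte'
          have hc4 := hHm (t + 1) e (by omega) hte' le_rfl
          have hc5 := hHm s (t + 1) (by omega) (by omega) hte'
          have hadv := hcore'.advance hte'
          rw [hM'] at hadv
          rw [sum_Icc_eq_add _ hte', add_assoc t 1 1, one_add_one_eq_two] at hsum
          refine Or.inl ⟨_, _, ⟨hadv, ?_, ?_, hlong', fun M' hM' _ => ?_⟩, ?_, fun x hx => ?_⟩
          · rw [hparts, ← Multiset.singleton_add, ← Multiset.singleton_add]
            abel
          · simp only [hHt']
            omega
          · exact reach_of_eq hH (by simp) hlong' hHt' (by rw [hHt']; exact hc4) M' hM'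
          · simp only
            omega
          · have h1 := hshort x (Multiset.mem_cons_of_mem hx)
            simp only [hHt']
            omega
        · obtain rfl : t = e := by omega
          rw [Finset.Icc_eq_empty (by omega), Finset.sum_empty] at hsum
          have hL0 := eq_zero_of_sum_eq_zero (L := L) (fun x hx => by have := hlong' x hx; omega)
            (by omega)
          have hS0 := eq_zero_of_sum_eq_zero (L := Sh)
            (fun x hx => (hshort x (Multiset.mem_cons_of_mem hx)).1) (by omega)
          have hfin := hcore'.finish
          rw [hM'] at hfin
          refine Or.inr ⟨hL0, hS0, ?_⟩
          simp only
          rw [hparts, hL0, hS0]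
          convert hfin using 1
          simp only [Multiset.cons_zero]
          abel
      · rw [if_neg (by omega)]
        -- Case (1d): the rest of column `t` is higher than `m`, hence than all short parts, as its
        -- role of scion requires.
        obtain ⟨G', hG', -, hh, hcore'⟩ := hcore.graft hr hte (k := M - G.height s) (by omega)
          (by omega) (hle1 _ (by omega))
        rw [hG', Option.bind_some]
        rw [show G.height s + (M - G.height s) = M by omega, part_of_pos (by omega)] at hcore'
        refine ⟨_, rfl, by simp, Or.inl ⟨_, _, ⟨hcore', ?_, ?_, hlong', fun M' hM' _ => ?_⟩, ?_,
          fun x hx => ?_⟩⟩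
        · rw [hparts, ← Multiset.singleton_add M]
          abel
        · simp only [hh, Multiset.sum_cons]
          omega
        · exact reach_of_eq hH (by simp) hlong' hh (by rw [hh]; omega) M' hM'
        · simp only [Multiset.card_cons]
          omega
        · have h1 := hshort x hx
          have h2 : x ≤ m := by
            rcases Multiset.mem_cons.1 hx with rfl | hx
            exacts [le_rfl, hmmax x hx]
          simp only [hh]
          omega

end NilpotentCompletion

namespace NilpotentCompletion

/-! ### Loop 2, and termination of both loops. -/

variable {n r e f c : ℕ} {H : ℕ → ℕ} {l : ℕ} {P : Multiset ℕ} {lam : Multiset ℕ} {S : State n}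

/-- Equality of the sums leaves no column and an empty scion. Such a scion arises from (2b) when `f
= 1`. -/
theorem Invariant.isComplete (hH : IsProfile e f c H) (h : Invariant r e H lam S l P)
    (hL : S.long = 0) (hS : S.short = 0) : IsComplete r lam S := by
  have h1 := h.sum_eq
  have h2 := h.inProgress.stock_le
  have h3 := h.inProgress.scion_lt
  rw [hL, hS, Multiset.sum_zero] at h1
  have h4 : S.stock = e + 1 := by
    by_contra hne
    have hle : S.stock ≤ e := by omega
    rw [sum_Icc_eq_add _ hle] at h1
    have h5 := hH.pos
    have h6 := hH.le
    have := hH.eq_or S.stock (by omega) hle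
    omega
  have hfin := (h4 ▸ h.inProgress : InProgress r e H S.graph S.scion (e + 1) l P).finish
  rw [show S.graph.height S.scion = 0 by omega, part_zero] at hfin
  refine ⟨hL, hS, ?_⟩
  rw [h.parts_eq, hL, hS, add_zero]
  exact hfin

/-- A whole column may always be grafted, since the lowest grafted vertex has level 1. `reach`
survives because `M` exceeds the old height by more than `c`. -/
theorem littleLoopBody_spec (hr : 0 < r) (hH : IsProfile e f c H) (h : Invariant r e H lam S l P)
    {M : ℕ} {L : Multiset ℕ} (hL : S.long = M ::ₘ L) (hM : S.graph.height S.scion + c < M) :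
    S.stock ≤ e ∧ ∃ T, littleLoopBody S = some T ∧ T.stock = S.stock + 1 ∧ T.long = S.long ∧
      T.short = S.short ∧ ∃ l P, Invariant r e H lam T l P := by
  obtain ⟨G, s, t, L', Sh⟩ := S
  simp only at hL hM
  subst hL
  obtain ⟨hcore, hparts, hsum, hlong, hreach⟩ := h
  simp only at hcore hparts hsum hlong hreach
  have hst := hcore.scion_lt
  have hs1 := hcore.scion_pos
  have hpos := hH.pos
  have hfc := hH.le
  have hte : t ≤ e := by
    by_contra hne
    rw [Finset.Icc_eq_empty (by omega), Finset.sum_empty, Multiset.sum_cons] at hsum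
    omega
  have hHt := hcore.height_eq t le_rfl hte
  have hc1 := hH.eq_or t (by omega) hte
  obtain ⟨G', hG', ⟨hh, hcore'⟩, -⟩ := hcore.graft hr hte (k := H t) (by omega)
    le_rfl (by omega)
  rw [Nat.sub_self, part_zero, add_zero] at hcore'
  rw [sum_Icc_eq_add _ hte] at hsum
  refine ⟨hte, ⟨G', s, t + 1, M ::ₘ L, Sh⟩, ?_, rfl, rfl, rfl, _, _, hcore', hparts, ?_, hlong,
    fun M' hM' hmax' => ?_⟩
  · unfold littleLoopBody
    simp only [Graph.height?_eq_some (show 0 < G.height t by omega), Option.bind_eq_bind,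
      Option.bind_some, hHt, hG']
  · simp only [hh]
    omega
  · have h1 := hmax' M (Multiset.mem_cons_self _ _)
    simp only [hh]
    refine ⟨by omega, fun h2 => ?_⟩
    have hc2 := hH.eq_or (t + 1) (by omega) h2
    omega

theorem littleLoopCond_eq {M : ℕ} {L : Multiset ℕ} (hL : S.long = M ::ₘ L)
    (hmax : ∀ x ∈ L, x ≤ M) (hc : n ⌈/⌉ r = c) :
    littleLoopCond r S = some (decide (S.graph.height S.scion + c < M)) := by
  unfold littleLoopCond
  rw [hL, max?_cons hmax, hc]
  simp only [Option.bind_eq_bind, Option.bind_some, Option.some.injEq, decide_eq_decide]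
  omega

theorem littleLoop_spec (hr : 0 < r) (hH : IsProfile e f c H) (hc : n ⌈/⌉ r = c)
    (h : Invariant r e H lam S l P) {M : ℕ} {L : Multiset ℕ} (hL : S.long = M ::ₘ L)
    (hmax : ∀ x ∈ L, x ≤ M) :
    ∃ T, LittleLoop r S T ∧ T.long = S.long ∧ T.short = S.short ∧
      M ≤ T.graph.height T.scion + c ∧ ∃ l P, Invariant r e H lam T l P := by
  obtain ⟨d, hd⟩ : ∃ d, d = e + 1 - S.stock := ⟨_, rfl⟩
  induction d using Nat.strong_induction_on generalizing S l P with
  | _ d ih =>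
    have hcond := littleLoopCond_eq hL hmax hc
    by_cases hM : S.graph.height S.scion + c < M
    · obtain ⟨hte, T, hT, ht, hTL, hTS, l', P', hinv⟩ := littleLoopBody_spec hr hH h hL hM
      obtain ⟨U, hU, hUL, hUS, hUM, hUinv⟩ := ih (e + 1 - T.stock) (by omega) hinv
        (hTL.trans hL) rfl
      refine ⟨U, .step (by rw [hcond, decide_eq_true hM]) hT hU, hUL.trans hTL, hUS.trans hTS,
        hUM, hUinv⟩
    · exact ⟨S, .done (by rw [hcond, decide_eq_false hM]), rfl, rfl, by omega, l, P, h⟩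

theorem loop2Finish_spec (hr : 0 < r) (hH : IsProfile e f c H) (hc : n ⌈/⌉ r = c) (hf : n / r = f)
    (h : Invariant r e H lam S l P) {M : ℕ} {L : Multiset ℕ} (hL : S.long = M ::ₘ L)
    (hmax : ∀ x ∈ L, x ≤ M) (hM : M ≤ S.graph.height S.scion + c) (hS : S.short = 0) :
    ∃ T, loop2Finish r S = some T ∧ T.long = L ∧ T.short = 0 ∧
      ((∃ l P, Invariant r e H lam T l P) ∨ IsComplete r lam T) := by
  obtain ⟨G, s, t, L', Sh⟩ := S
  simp only at hL hM hS
  subst hL hS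
  obtain ⟨hcore, hparts, hsum, hlong, hreach⟩ := h
  simp only at hcore hparts hsum hlong hreach
  have hst := hcore.scion_lt
  have hs1 := hcore.scion_pos
  have hpos := hH.pos
  have hfc := hH.le
  have hcf := hH.le_succ
  have hreachM := hreach M (Multiset.mem_cons_self _ _) fun x hx => by
    rcases Multiset.mem_cons.1 hx with rfl | hx
    exacts [le_rfl, hmax x hx]
  have hlong' : ∀ x ∈ L, H e < x := fun x hx => hlong x (Multiset.mem_cons_of_mem hx)
  simp only [Multiset.sum_cons, Multiset.sum_zero, add_zero] at hsum hparts
  have hte : t ≤ e := by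
    by_contra hne
    rw [Finset.Icc_eq_empty (by omega), Finset.sum_empty] at hsum
    omega
  have hreach2 := hreachM.2 hte
  have hHt := hcore.height_eq t le_rfl hte
  have hc1 := hH.eq_or t (by omega) hte
  have htt := hH.mono t e (by omega) hte le_rfl
  have hht : G.height? t = some (H t) := by
    rw [← hHt]
    exact Graph.height?_eq_some (by omega)
  rw [sum_Icc_eq_add _ hte] at hsum
  unfold loop2Finish
  simp only [max?_cons hmax, hht, Option.bind_eq_bind, Option.bind_some, cons_sub_singleton, hc, hf]
  -- Together with `hM` this forces `H t = f`, `c = f + 1` and `M = h(s) + c`.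
  by_cases ha : G.height s + H t < M
  · rw [if_pos (by omega)]
    have hte' : t + 1 ≤ e := by
      by_contra hne
      rw [Finset.Icc_eq_empty (by omega), Finset.sum_empty] at hsum
      omega
    have hHt' := hcore.height_eq (t + 1) (by omega) hte'
    have hc2 := hH.eq_or (t + 1) (by omega) hte'
    have htt' := hH.mono (t + 1) e (by omega) hte' le_rfl
    rw [sum_Icc_eq_add _ hte', add_assoc t 1 1, one_add_one_eq_two] at hsum
    rw [Graph.height?_eq_some (by omega), Option.bind_some, hHt']
    by_cases hb : H (t + 1) = c
    · rw [if_pos hb]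
      obtain ⟨G', hG', hh, hcore'⟩ := hcore.graft_next hr hte' (k := H (t + 1)) (by omega)
        le_rfl (by omega)
      rw [Nat.sub_self, part_zero, add_zero, show G.height s + H (t + 1) = M by omega,
        part_of_pos (by omega)] at hcore'
      rw [hG', Option.bind_some]
      refine ⟨_, rfl, rfl, rfl, Or.inl ⟨_, _, hcore', ?_, ?_, hlong', fun M' hM' _ => ?_⟩⟩
      · rw [hparts, ← Multiset.singleton_add]
        abel
      · simp only [hh, Multiset.sum_zero]
        omega
      · exact reach_of_eq hH (by simp) hlong' hh (by rw [hh]; exact htt) M' hM'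
    -- Case (2b): after column `t` is grafted, `l = f`. Taking one vertex from a column of height
    -- `f` meets the level condition with equality; a column of height `c` would violate it.
    · rw [if_neg hb, if_pos (by omega)]
      obtain ⟨G', hG', ⟨hh, hcore'⟩, -⟩ := hcore.graft hr hte (k := H t) (by omega)
        le_rfl (by omega)
      rw [Nat.sub_self, part_zero, add_zero] at hcore'
      obtain ⟨G'', hG'', -, hh', hcore''⟩ := hcore'.graft hr hte' (k := 1) one_pos (by omega)
        (by omega)
      rw [hG', Option.bind_some, hG'', Option.bind_some]
      rw [hh, show G.height s + H t + 1 = M by omega, part_of_pos (by omega)] at hcore''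
      refine ⟨_, rfl, rfl, rfl, Or.inl ⟨_, _, hcore'', ?_, ?_, hlong', fun M' hM' _ => ?_⟩⟩
      · rw [hparts, ← Multiset.singleton_add]
        abel
      · simp only [hh', Multiset.sum_zero]
        omega
      · exact reach_of_eq hH (by simp) hlong' hh' (by rw [hh']; omega) M' hM'
  · rw [if_neg (by omega)]
    by_cases hb : G.height s + H t = M
    · rw [if_pos (by omega)]
      obtain ⟨G', hG', ⟨hh, hcore'⟩, -⟩ := hcore.graft hr hte (k := H t) (by omega)
        le_rfl (by omega)
      rw [Nat.sub_self, part_zero, add_zero] at hcore'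
      rw [hG', Option.bind_some]
      refine ⟨_, rfl, rfl, rfl, ?_⟩
      have hM' : part (G'.height s) = {M} := by rw [hh, hb, part_of_pos (by omega)]
      by_cases hte' : t + 1 ≤ e
      · have hHt' := hcore'.height_eq (t + 1) le_rfl hte'
        have htt' := hH.mono (t + 1) e (by omega) hte' le_rfl
        have hadv := hcore'.advance hte'
        rw [hM'] at hadv
        rw [sum_Icc_eq_add _ hte', add_assoc t 1 1, one_add_one_eq_two] at hsum
        refine Or.inl ⟨_, _, hadv, ?_, ?_, hlong', fun M' hM' _ => ?_⟩
        · rw [hparts, ← Multiset.singleton_add]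
          abel
        · simp only [hHt', Multiset.sum_zero]
          omega
        · exact reach_of_eq hH (by simp) hlong' hHt' (by rw [hHt']; exact htt') M' hM'
      · obtain rfl : t = e := by omega
        rw [Finset.Icc_eq_empty (by omega), Finset.sum_empty] at hsum
        have hL0 := eq_zero_of_sum_eq_zero (L := L) (fun x hx => by have := hlong' x hx; omega)
          (by omega)
        have hfin := hcore'.finish
        rw [hM'] at hfin
        refine Or.inr ⟨hL0, rfl, ?_⟩
        simp only
        rw [hparts, hL0]
        exact hfin
    · rw [if_neg (by omega)]
      obtain ⟨G', hG', -, hh, hcore'⟩ := hcore.graft hr hte (k := M - G.height s) (by omega)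
        (by omega) (by omega)
      rw [hG', Option.bind_some]
      rw [show G.height s + (M - G.height s) = M by omega, part_of_pos (by omega)] at hcore'
      refine ⟨_, rfl, rfl, rfl, Or.inl ⟨_, _, hcore', ?_, ?_, hlong', fun M' hM' _ => ?_⟩⟩
      · rw [hparts, ← Multiset.singleton_add]
        abel
      · simp only [hh, Multiset.sum_zero]
        omega
      · exact reach_of_eq hH (by simp) hlong' hh (by rw [hh]; omega) M' hM'

/-- Induction on the number of remaining parts, which every iteration decreases. -/
theorem loop1_spec (hr : 0 < r) (hH : IsProfile e f c H)
    (h : (∃ l P, Invariant₁ r e H lam S l P) ∨ IsComplete r lam S) :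
    ∃ T, Loop1 S T ∧ T.short = 0 ∧ ((∃ l P, Invariant r e H lam T l P) ∨ IsComplete r lam T) := by
  obtain ⟨d, hd⟩ : ∃ d, d = S.long.card + S.short.card := ⟨_, rfl⟩
  induction d using Nat.strong_induction_on generalizing S with
  | _ d ih =>
    by_cases hS : S.short = 0
    · exact ⟨S, .done (by simp [hS]), hS, h.imp_left fun ⟨l, P, h⟩ => ⟨l, P, h.toInvariant⟩⟩
    · rcases h with ⟨l, P, h⟩ | h
      · obtain ⟨T, hT, hlt, h'⟩ := loop1Body_spec hr hH h hS
        obtain ⟨U, hU, hU'⟩ := ih _ (by omega) h' rfl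
        exact ⟨U, .step (by simp [hS]) hT hU, hU'⟩
      · exact absurd h.2.1 hS

/-- Induction on the number of long parts; each iteration finishes one, after a Little Loop limited
by the supply of columns. -/
theorem loop2_spec (hr : 0 < r) (hH : IsProfile e f c H) (hc : n ⌈/⌉ r = c) (hf : n / r = f)
    (hS : S.short = 0) (h : (∃ l P, Invariant r e H lam S l P) ∨ IsComplete r lam S) :
    ∃ T, Loop2 r S T ∧ IsComplete r lam T := by
  obtain ⟨d, hd⟩ : ∃ d, d = S.long.card := ⟨_, rfl⟩
  induction d using Nat.strong_induction_on generalizing S with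
  | _ d ih =>
    by_cases hL : S.long = 0
    · refine ⟨S, .done (by simp [hL]), ?_⟩
      rcases h with ⟨l, P, h⟩ | h
      exacts [h.isComplete hH hL hS, h]
    · rcases h with ⟨l, P, h⟩ | h
      · obtain ⟨M, L, hML, hmax⟩ := exists_cons_max hL
        obtain ⟨T, hT, hTL, hTS, hTM, l', P', hinv⟩ := littleLoop_spec hr hH hc h hML hmax
        obtain ⟨U, hU, hUL, hUS, hU'⟩ := loop2Finish_spec hr hH hc hf hinv (hTL.trans hML) hmax hTM
          (hTS.trans hS)
        obtain ⟨V, hV, hV'⟩ := ih U.long.card (by rw [hd, hML, hUL]; simp) hUS hU' rfl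
        exact ⟨V, .step (by simp [hL]) ⟨T, hT, hU⟩ hV, hV'⟩
      · exact absurd h.1 hL

end NilpotentCompletion

namespace NilpotentCompletion

/-! ### The initial state -/

theorem sum_Icc_split {M : Type*} [AddCommMonoid M] (F : ℕ → M) {u v w : ℕ} (h1 : u ≤ v + 1)
    (h2 : v ≤ w) :
    ∑ j ∈ Finset.Icc u w, F j = ∑ j ∈ Finset.Icc u v, F j + ∑ j ∈ Finset.Icc (v + 1) w, F j := by
  rw [← Finset.sum_union]
  · congr 1
    ext j
    simp
    omega
  · rw [Finset.disjoint_left]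
    intro j hj hj'
    simp at hj hj'
    omega

variable {n r : ℕ}

/-- The heights of the columns of the graph of `N_r`. -/
def initialHeight (n r j : ℕ) : ℕ := (n - 1 + j) / r

theorem initialHeight_eq (hr : 0 < r) (hrn : r < n) {j : ℕ} (h1 : 1 ≤ j) (h2 : j ≤ r) :
    initialHeight n r j = if j + n % r ≤ r then n / r else n / r + 1 := by
  have h3 := Nat.mod_add_div n r
  have h4 := Nat.mod_lt n hr
  rw [mul_comm] at h3
  rw [initialHeight]
  split_ifs with h
  · apply Nat.div_eq_of_lt_le
    · omega
    · rw [Nat.succ_mul]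
      omega
  · apply Nat.div_eq_of_lt_le
    · rw [Nat.succ_mul]
      omega
    · rw [Nat.succ_mul, Nat.succ_mul]
      omega

theorem ceilDiv_eq_ite (hr : 0 < r) :
    n ⌈/⌉ r = if n % r = 0 then n / r else n / r + 1 := by
  have h3 := Nat.mod_add_div n r
  have h4 := Nat.mod_lt n hr
  rw [mul_comm] at h3
  rw [Nat.ceilDiv_eq_add_pred_div]
  split_ifs with h
  · apply Nat.div_eq_of_lt_le
    · omega
    · rw [Nat.succ_mul]
      omega
  · apply Nat.div_eq_of_lt_le
    · rw [Nat.succ_mul]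
      omega
    · rw [Nat.succ_mul, Nat.succ_mul]
      omega

theorem isProfile_initialHeight (hr : 0 < r) (hrn : r < n) {e : ℕ} (he : e ≤ r) :
    IsProfile e (n / r) (n ⌈/⌉ r) (initialHeight n r) where
  pos := Nat.div_pos hrn.le hr
  le := by
    rw [ceilDiv_eq_ite hr]
    split_ifs <;> omega
  le_succ := by
    rw [ceilDiv_eq_ite hr]
    split_ifs <;> omega
  eq_or j h1 h2 := by
    rw [ceilDiv_eq_ite hr, initialHeight_eq hr hrn h1 (by omega)]
    split_ifs <;> omega
  mono i j _ h _ := Nat.div_le_div_right (by omega)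

theorem sum_initialHeight (hr : 0 < r) (hrn : r < n) :
    ∑ j ∈ Finset.Icc 1 r, initialHeight n r j = n := by
  have h3 := Nat.mod_add_div n r
  have h4 := Nat.mod_lt n hr
  have h5 : ∀ j ∈ Finset.Icc 1 (r - n % r), initialHeight n r j = n / r := by
    intro j hj
    rw [Finset.mem_Icc] at hj
    rw [initialHeight_eq hr hrn hj.1 (by omega), if_pos (by omega)]
  have h6 : ∀ j ∈ Finset.Icc (r - n % r + 1) r, initialHeight n r j = n / r + 1 := by
    intro j hj
    rw [Finset.mem_Icc] at hj
    rw [initialHeight_eq hr hrn (by omega) hj.2, if_neg (by omega)]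
  rw [sum_Icc_split _ (by omega : 1 ≤ r - n % r + 1) (by omega), Finset.sum_congr rfl h5,
    Finset.sum_congr rfl h6]
  simp only [Finset.sum_const, Nat.card_Icc, smul_eq_mul]
  rw [show r - n % r + 1 - 1 = r - n % r by omega,
    show r + 1 - (r - n % r + 1) = n % r by omega, mul_add, ← add_assoc, ← add_mul,
    Nat.sub_add_cancel h4.le]
  omega

/-- The parts of `lam` made by the columns which are not used by the algorithm. -/
def unusedParts (n r : ℕ) (lam : Multiset ℕ) : Multiset ℕ :=
  Multiset.replicate (min (lam.count (n / r)) (r - n % r)) (n / r) +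
    Multiset.replicate (min (lam.count (n ⌈/⌉ r)) (n % r)) (n ⌈/⌉ r)

theorem parts_eq_initialState (hr : 0 < r) {lam : n.Partition} (hlam : lam.parts.card ≤ r) :
    lam.parts = unusedParts n r lam.parts + (initialState r lam).long +
      (initialState r lam).short := by
  have hf := lam.parts.count_le_card (n / r)
  have hc := ceilDiv_eq_ite (n := n) hr
  have h4 := Nat.mod_lt n hr
  ext x
  have hfx : n / r = x → lam.parts.count x = lam.parts.count (n / r) := fun h => by rw [h]
  have hcx : n ⌈/⌉ r = x → lam.parts.count x = lam.parts.count (n ⌈/⌉ r) := fun h => by rw [h]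
  simp only [initialState, unusedParts, Multiset.count_add, Multiset.count_replicate,
    Multiset.count_filter, apply_ite (Multiset.count x), Multiset.count_zero]
  generalize lam.parts.count x = u at *
  generalize lam.parts.count (n / r) = v at *
  generalize lam.parts.count (n ⌈/⌉ r) = w at *
  generalize n ⌈/⌉ r = c at *
  generalize n / r = f at *
  split_ifs at * <;> omega

/-- The active columns are `a + 1, …, r - b`. If a copy of `c` is still to be made, all columns of
height `c` are set aside, so the last active one is lower than `c`; likewise for `f` and the first
active column. -/
theorem initialState_spec (hr : 0 < r) (hrn : r < n) {lam : n.Partition}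
    (hlam : lam.parts.card ≤ r) :
    ∃ e f c H, IsProfile e f c H ∧ n ⌈/⌉ r = c ∧ n / r = f ∧
      ((∃ l P, Invariant₁ r e H lam.parts (initialState r lam) l P) ∨
        IsComplete r lam.parts (initialState r lam)) := by
  have hmod := Nat.mod_lt n hr
  have hceil := ceilDiv_eq_ite (n := n) hr
  have hHeq := fun j => initialHeight_eq (j := j) hr hrn
  have hlameq := parts_eq_initialState hr hlam
  set a := min (lam.parts.count (n / r)) (r - n % r) with ha
  set b := min (lam.parts.count (n ⌈/⌉ r)) (n % r) with hb
  have hprof := isProfile_initialHeight hr hrn (e := r - b) (by omega)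
  refine ⟨r - b, _, _, _, hprof, rfl, rfl, ?_⟩
  have hleft : ∀ j ∈ Finset.Icc 1 a, initialHeight n r j = n / r := by
    intro j hj
    rw [Finset.mem_Icc] at hj
    rw [hHeq j hj.1 (by omega), if_pos (by omega)]
  have hright : ∀ j ∈ Finset.Icc (r - b + 1) r, initialHeight n r j = n ⌈/⌉ r := by
    intro j hj
    rw [Finset.mem_Icc] at hj
    rw [hHeq j (by omega) hj.2, if_neg (by omega), hceil, if_neg (by omega)]
  have hpos := hprof.pos
  have hfc := hprof.le
  have hcardD : (unusedParts n r lam.parts).card = a + b := by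
    simp [unusedParts, ha, hb]
  have hsumD : (unusedParts n r lam.parts).sum = a * (n / r) + b * (n ⌈/⌉ r) := by
    simp [unusedParts, ha, hb]
  have hcard := congrArg Multiset.card hlameq
  have hsum := congrArg Multiset.sum hlameq
  rw [Multiset.card_add, Multiset.card_add, hcardD] at hcard
  rw [Multiset.sum_add, Multiset.sum_add, hsumD, lam.parts_sum] at hsum
  have hgraph : (initialState r lam).graph = Graph.ofSubdiagonal n r := rfl
  have hheight : ∀ j, 1 ≤ j → j ≤ r →
      (Graph.ofSubdiagonal n r).height j = initialHeight n r j :=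
    fun j h1 h2 => Graph.ofSubdiagonal_height hr hrn h1 h2
  have hparts : columnParts r (Graph.ofSubdiagonal n r).height =
      unusedParts n r lam.parts + ∑ j ∈ Finset.Icc (a + 1) (r - b), part (initialHeight n r j) := by
    rw [columnParts, Finset.sum_congr rfl fun j hj => by
        rw [hheight j (Finset.mem_Icc.1 hj).1 (Finset.mem_Icc.1 hj).2],
      sum_Icc_split _ (by omega : 1 ≤ r - b + 1) (by omega : r - b ≤ r),
      sum_Icc_split _ (by omega : 1 ≤ a + 1) (by omega : a ≤ r - b),
      Finset.sum_congr rfl fun j hj => by rw [hleft j hj],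
      Finset.sum_congr (s₁ := Finset.Icc (r - b + 1) r) rfl fun j hj => by rw [hright j hj],
      part_of_pos hpos, part_of_pos (hpos.trans_le hfc)]
    simp only [Finset.sum_const, Nat.card_Icc, Multiset.nsmul_singleton, unusedParts]
    rw [show a + 1 - 1 = a by omega, show r + 1 - (r - b + 1) = b by omega, ← ha, ← hb]
    abel
  have hsumH : n = a * (n / r) + b * (n ⌈/⌉ r) +
      ∑ j ∈ Finset.Icc (a + 1) (r - b), initialHeight n r j := by
    have h := sum_initialHeight hr hrn
    rw [sum_Icc_split _ (by omega : 1 ≤ r - b + 1) (by omega : r - b ≤ r),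
      sum_Icc_split _ (by omega : 1 ≤ a + 1) (by omega : a ≤ r - b),
      Finset.sum_congr rfl hleft,
      Finset.sum_congr (s₁ := Finset.Icc (r - b + 1) r) rfl hright] at h
    simp only [Finset.sum_const, Nat.card_Icc, smul_eq_mul] at h
    rw [show a + 1 - 1 = a by omega, show r + 1 - (r - b + 1) = b by omega] at h
    omega
  by_cases hae : a + 1 ≤ r - b
  · left
    have hhs := hheight (a + 1) (by omega) (by omega)
    have hHs := hHeq (a + 1) (by omega) (by omega)
    have hHe := hHeq (r - b) (by omega) (by omega)
    have hgr := Graph.isGrafted_ofSubdiagonal (n := n) hr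
    rw [sum_Icc_eq_add _ hae] at hparts hsumH
    have hlong : ∀ x ∈ (initialState r lam).long, initialHeight n r (r - b) < x := by
      intro x hx
      simp only [initialState, Multiset.mem_add, Multiset.mem_filter] at hx
      rcases hx with hx | hx
      · have := hprof.eq_or (r - b) (by omega) le_rfl
        omega
      · split_ifs at hx with h
        · rw [Multiset.eq_of_mem_replicate hx, hHe, hceil, if_pos (by omega), if_neg h.1]
          omega
        · simp at hx
    refine ⟨initialHeight n r (a + 1), unusedParts n r lam.parts, ⟨⟨hgr.mono (Set.subset_univ _),
      ?_, hhs.ge, by simp [initialState], by simp [initialState], hae, ?_, by omega,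
      fun j h1 h2 => hheight j (le_trans (by simp [initialState]) h1) (by omega), ?_⟩, hlameq, ?_,
      hlong, fun M hM _ => ?_⟩, ?_, fun x hx => ?_⟩
    · rw [← hhs]
      exact hgr.topFrom_of_mem (Set.mem_univ _)
    · simp only [initialState]
      omega
    · rw [hgraph, hparts, ← add_assoc, ← hhs]
      rfl
    · change (Graph.ofSubdiagonal n r).height (a + 1) +
        ∑ j ∈ Finset.Icc (a + 1 + 1) (r - b), initialHeight n r j = _
      omega
    · exact reach_of_eq hprof (by simp [initialState]) hlong hhs
        (hhs.trans_le (hprof.mono _ _ (by omega) hae le_rfl)) M hM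
    · change _ ≤ 1 + (r - b + 1 - (a + 1 + 1))
      omega
    · have hx' : 0 < x ∧ x < initialHeight n r (a + 1) := by
        simp only [initialState, Multiset.mem_add, Multiset.mem_filter] at hx
        rcases hx with hx | hx
        · have := lam.parts_pos hx.1
          have := hprof.eq_or (a + 1) (by omega) hae
          omega
        · split_ifs at hx with h
          · rw [Multiset.eq_of_mem_replicate hx, hHs, if_neg (by omega)]
            omega
          · simp at hx
      exact ⟨hx'.1, hx'.2, hx'.2.trans_eq hhs.symm, hx'.2⟩
  -- All columns are set aside, so the at most `r` parts of `lam` are used up and both multisets are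
  -- empty.
  · right
    have hL : (initialState r lam).long = 0 := Multiset.card_eq_zero.1 (by omega)
    have hS : (initialState r lam).short = 0 := Multiset.card_eq_zero.1 (by omega)
    refine ⟨hL, hS, ⟨_, Graph.isGrafted_ofSubdiagonal hr⟩, ?_⟩
    rw [hgraph, hparts, Finset.Icc_eq_empty (by omega), Finset.sum_empty]
    conv_rhs => rw [hlameq, hL, hS]
    simp

theorem exists_terminatesIn (hr : 0 < r) (hrn : r < n) {lam : n.Partition}
    (hlam : lam.parts.card ≤ r) :
    ∃ T : State n, TerminatesIn r lam T ∧ IsFinished r T.graph lam.parts := by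
  obtain ⟨e, f, c, H, hH, hc, hf, h⟩ := initialState_spec hr hrn hlam
  obtain ⟨S, hS, hS0, hS'⟩ := loop1_spec hr hH h
  obtain ⟨T, hT, -, -, hfin⟩ := loop2_spec hr hH hc hf hS0 hS'
  exact ⟨T, ⟨S, hS, hT⟩, hfin⟩

/-! ### Uniqueness of the final state -/

/-- The condition decides between stopping and continuing, so a functional body makes the run
deterministic. For Loop 2 the body is functional because the Little Loop itself has a unique result.
-/
theorem WhileRun.unique {σ : Type} {cond : σ → Option Bool} {body : σ → σ → Prop}
    (hbody : ∀ s t t', body s t → body s t' → t = t') {s t t' : σ}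
    (h : WhileRun cond body s t) (h' : WhileRun cond body s t') : t = t' := by
  induction h with
  | done hc =>
    cases h' with
    | done => rfl
    | step hc' => simp [hc] at hc'
  | step hc hb _ ih =>
    cases h' with
    | done hc' => simp [hc] at hc'
    | step _ hb' hrun =>
      rw [hbody _ _ _ hb' hb] at hrun
      exact ih hrun

theorem TerminatesIn.unique {lam : n.Partition} {T T' : State n} (h : TerminatesIn r lam T)
    (h' : TerminatesIn r lam T') : T = T' := by
  obtain ⟨S, h1, h2⟩ := h
  obtain ⟨S', h1', h2'⟩ := h'
  obtain rfl : S = S' := h1.unique (fun s t t' ht ht' => Option.some_injective _ (ht ▸ ht')) h1'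
  refine h2.unique ?_ h2'
  rintro s t t' ⟨u, hu, ht⟩ ⟨u', hu', ht'⟩
  obtain rfl : u = u' := hu.unique (fun _ _ _ ht ht' => Option.some_injective _ (ht ▸ ht')) hu'
  exact Option.some_injective _ (ht ▸ ht')

/-! ### The output -/

theorem IsFinished.isNilpotentOfType {G : Graph n} {lam : n.Partition}
    (h : IsFinished r G lam.parts) : IsNilpotentOfType G.toMatrix lam := by
  obtain ⟨⟨U, hU⟩, hparts⟩ := h
  -- Empty columns are dropped: they carry no Jordan block.
  set F := (Finset.Icc 1 r).filter fun j => G.height j ≠ 0 with hF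
  refine Graph.isNilpotentOfType_toMatrix hU.isEmbedded hU.isProperlyDownward
    (col := fun i : Fin F.card => (F.equivFin.symm i : ℕ))
    (Subtype.val_injective.comp F.equivFin.symm.injective) (fun v => ?_) ?_
  · have h1 := hU.isEmbedded.2 v
    have h2 := G.y_le_height v
    have hv : G.x v ∈ F := by
      rw [hF, Finset.mem_filter, Finset.mem_Icc]
      exact ⟨⟨h1.1, hU.x_le v⟩, by omega⟩
    exact ⟨F.equivFin ⟨G.x v, hv⟩, by simp⟩
  · rw [← hparts, columnParts, ← Multiset.sum_map_singleton (Multiset.map _ _), Multiset.map_map]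
    change ∑ i : Fin F.card, ({G.height (F.equivFin.symm i : ℕ)} : Multiset ℕ) = _
    rw [Equiv.sum_comp F.equivFin.symm fun j => ({G.height (j : ℕ)} : Multiset ℕ),
      Finset.sum_coe_sort F fun j => ({G.height j} : Multiset ℕ), hF, Finset.sum_filter]
    refine Finset.sum_congr rfl fun j _ => ?_
    simp only [part]
    split_ifs <;> simp_all

theorem completion_apply (T : State n) (i j : Fin n) :
    T.completion r i j = (if (j, i) ∈ T.graph.arrows then 1 else 0) -
      if (i : ℕ) = j + r then 1 else 0 := rfl

theorem IsFinished.isBinary {T : State n} {P : Multiset ℕ} (h : IsFinished r T.graph P) :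
    IsBinary (T.completion r) := by
  obtain ⟨⟨U, hU⟩, -⟩ := h
  intro i j
  have h1 := hU.mem_arrows j i
  rw [completion_apply]
  split_ifs <;> simp_all

theorem IsFinished.isStrictlyUpper {T : State n} {P : Multiset ℕ} (h : IsFinished r T.graph P) :
    IsStrictlyUpper (T.completion r) := by
  obtain ⟨⟨U, hU⟩, -⟩ := h
  intro i j hij
  have h1 := hU.mem_arrows j i
  have h2 := hU.arrow_cases j i
  have h3 : ¬ i < j := not_lt.2 hij
  rw [completion_apply]
  split_ifs <;> simp_all

theorem subdiagonalMatrix_add_completion (T : State n) :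
    subdiagonalMatrix n r + T.completion r = T.graph.toMatrix :=
  add_sub_cancel _ _

/-! ### The number of Jordan blocks of `N_r` -/

/-- The first basis vectors of the Jordan blocks span a `k`-dimensional space killed by the Jordan
matrix. `P` carries it into the kernel of `N_r`, whose vectors are determined by their last `r`
coordinates. -/
theorem card_parts_le_of_isNilpotentOfType (hrn : r < n) {mu : n.Partition}
    (h : IsNilpotentOfType (subdiagonalMatrix n r) mu) : mu.parts.card ≤ r := by
  obtain ⟨-, k, sizes, e, P, hparts, hP⟩ := h
  have hpos : ∀ i, 0 < sizes i := fun i => mu.parts_pos <| by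
    rw [← hparts]
    exact Multiset.mem_map_of_mem _ (Finset.mem_univ i)
  rw [← hparts, Multiset.card_map, Finset.card_val, Finset.card_univ, Fintype.card_fin]
  let D : (Fin k → ℂ) →ₗ[ℂ] (Fin n → ℂ) := LinearMap.pi fun z =>
    if ((e.symm z).2 : ℕ) = 0 then (LinearMap.proj (e.symm z).1 : (Fin k → ℂ) →ₗ[ℂ] ℂ) else 0
  have hD : ∀ c z, D c z = if ((e.symm z).2 : ℕ) = 0 then c (e.symm z).1 else 0 := by
    intro c z
    simp only [D, LinearMap.pi_apply]
    split_ifs <;> simp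
  have hJD : ∀ c, Matrix.mulVec (Matrix.reindex e e (jordanMatrix sizes)) (D c) = 0 := by
    intro c
    funext u
    rw [Matrix.mulVec, dotProduct, Pi.zero_apply]
    refine Finset.sum_eq_zero fun z _ => ?_
    rw [Matrix.reindex_apply, Matrix.submatrix_apply, jordanMatrix_apply, hD]
    split_ifs <;> simp_all
  have hND : ∀ c, Matrix.mulVec (subdiagonalMatrix n r)
      (Matrix.mulVec (P : Matrix (Fin n) (Fin n) ℂ) (D c)) = 0 := by
    intro c
    rw [hP, Matrix.mulVec_mulVec, mul_assoc, Units.inv_mul, mul_one, ← Matrix.mulVec_mulVec, hJD,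
      Matrix.mulVec_zero]
  have hrow : ∀ w : Fin n → ℂ, Matrix.mulVec (subdiagonalMatrix n r) w = 0 →
      ∀ j : Fin n, (j : ℕ) + r < n → w j = 0 := by
    intro w hw j hj
    have h1 := congrFun hw ⟨j + r, hj⟩
    rw [Matrix.mulVec, dotProduct, Finset.sum_eq_single j] at h1
    · simpa [subdiagonalMatrix] using h1
    · intro z _ hz
      have : (j : ℕ) ≠ z := fun h => hz (Fin.ext h.symm)
      simp [subdiagonalMatrix, this]
    · simp
  -- Coefficients of the first basis vectors, conjugated by `P` and restricted to the last `r`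
  -- coordinates.
  let φ : (Fin k → ℂ) →ₗ[ℂ] (Fin r → ℂ) :=
    LinearMap.funLeft ℂ ℂ (fun j : Fin r => (⟨n - r + j, by omega⟩ : Fin n)) ∘ₗ
      Matrix.mulVecLin (P : Matrix (Fin n) (Fin n) ℂ) ∘ₗ D
  have hφ : Function.Injective φ := by
    rw [injective_iff_map_eq_zero]
    intro c hc
    have h0 : Matrix.mulVec (P : Matrix (Fin n) (Fin n) ℂ) (D c) = 0 := by
      funext z
      by_cases hz : (z : ℕ) + r < n
      · exact hrow _ (hND c) z hz
      · have h1 := congrFun hc ⟨z - (n - r), by omega⟩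
        have h2 : (⟨n - r + (z - (n - r)), by omega⟩ : Fin n) = z := Fin.ext (by simp; omega)
        simpa [φ, LinearMap.funLeft_apply, h2] using h1
    have h1 : D c = 0 := by
      have h2 := congrArg (Matrix.mulVec ((P⁻¹ : Matrix.GeneralLinearGroup (Fin n) ℂ) :
        Matrix (Fin n) (Fin n) ℂ)) h0
      rwa [Matrix.mulVec_mulVec, Units.inv_mul, Matrix.one_mulVec, Matrix.mulVec_zero] at h2
    funext i
    have h2 := congrFun h1 (e ⟨i, ⟨0, hpos i⟩⟩)
    rwa [hD, Equiv.symm_apply_apply, if_pos rfl] at h2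
  simpa using LinearMap.finrank_le_finrank_of_injective hφ

end NilpotentCompletion

/-! ### Assembly of the two statements. -/

theorem mainTheorem1 (n r : ℕ) (hr : 0 < r) (hrn : r < n) (lam : n.Partition) :
    (lam.parts.card ≤ r →
      ∃ T : NilpotentCompletion.State n,
        (∀ T', NilpotentCompletion.TerminatesIn r lam T' ↔ T' = T) ∧
        NilpotentCompletion.IsBinary (T.completion r) ∧
        NilpotentCompletion.IsStrictlyUpper (T.completion r) ∧
        NilpotentCompletion.IsNilpotentOfType
          (NilpotentCompletion.subdiagonalMatrix n r + T.completion r) lam) ∧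
    (∀ mu : n.Partition,
      NilpotentCompletion.IsNilpotentOfType (NilpotentCompletion.subdiagonalMatrix n r) mu →
      NilpotentCompletion.Dominates lam mu →
      ∃ T : NilpotentCompletion.State n,
        NilpotentCompletion.TerminatesIn r lam T ∧
        NilpotentCompletion.IsBinary (T.completion r) ∧
        NilpotentCompletion.IsStrictlyUpper (T.completion r) ∧
        NilpotentCompletion.IsNilpotentOfType
          (NilpotentCompletion.subdiagonalMatrix n r + T.completion r) lam) := by
  have hmain : lam.parts.card ≤ r →
      ∃ T : NilpotentCompletion.State n,
        NilpotentCompletion.TerminatesIn r lam T ∧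
        NilpotentCompletion.IsBinary (T.completion r) ∧
        NilpotentCompletion.IsStrictlyUpper (T.completion r) ∧
        NilpotentCompletion.IsNilpotentOfType
          (NilpotentCompletion.subdiagonalMatrix n r + T.completion r) lam := by
    intro hlam
    obtain ⟨T, hT, hfin⟩ := NilpotentCompletion.exists_terminatesIn hr hrn hlam
    refine ⟨T, hT, hfin.isBinary, hfin.isStrictlyUpper, ?_⟩
    rw [NilpotentCompletion.subdiagonalMatrix_add_completion]
    exact hfin.isNilpotentOfType
  refine ⟨fun hlam => ?_, fun mu hmu hdom =>
    hmain (hdom.1.trans (NilpotentCompletion.card_parts_le_of_isNilpotentOfType hrn hmu))⟩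
  obtain ⟨T, hT, h⟩ := hmain hlam
  exact ⟨T, fun T' => ⟨fun hT' => hT'.unique hT, fun hT' => hT' ▸ hT⟩, h⟩
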